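/- Let $N\ge 0$ be an integer and let $\omega\in\mathbb C$ with $0<|\omega|<1$. Let $q,t,u$ denote nonzero complex numbers. On the polynomial space $\mathbb C[x_1,\dots,x_N]$ let $\sigma_{ij}$ be the exchange of the variables $x_i$ and $x_j$, let $\gamma_i=q^{-x_i\partial_{x_i}}$ (i.e. $x_i\mapsto q^{-1}x_i$, the other variables being fixed), and for $i\ne j$ let $$R_{ij}(t)=\frac{x_i-t x_j}{x_i-x_j}+\frac{(t-1)x_j}{x_i-x_j}\,\sigma_{ij},$$ which is an invertible operator on $\mathbb C[x_1,\dots,x_N]$. The Cherednik operators are $$C_i(q,t)=t^{\,i-1}R_{i,i+1}(t)\cdots R_{iN}(t)\,\gamma_i\,R_{1,i}(t)^{-1}\cdots R_{i-1,i}(t)^{-1},\qquad 1\le i\le N,$$ and their double-elliptic versions are the operators on $\mathbb C[x_1,\dots,x_N]$ $$\mathrm P\theta_\omega(uC_i)=\sum_{n\in\mathbb Z}\omega^{\frac{n^2-n}{2}}(-u)^n\,C_i(q^n,t^n).$$ Let $D_N(u)$ be the operator from $\mathbb C[x_1,\dots,x_N]$ to $\mathbb C(x_1,\dots,x_N)$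 given by $$D_N(u)=\sum_{n_1,\dots,n_N\in\mathbb Z}\omega^{\sum_i\frac{n_i^2-n_i}{2}}(-u)^{\sum_i n_i}\prod_{1\le i<j\le N}\frac{t^{n_j}x_i-t^{n_i}x_j}{x_i-x_j}\;\prod_{i=1}^N\gamma_i^{n_i}.$$ A series of linear operators is said to converge if, applied to any vector, all its terms lie in one finite-dimensional subspace and the resulting series converges absolutely there. 1. For all nonzero $q,t,u$ the series defining $\mathrm P\theta_\omega(uC_1),\dots,\mathrm P\theta_\omega(uC_N)$ and $D_N(u)$ converge, and on the space $\Lambda_N\subset\mathbb C[x_1,\dots,x_N]$ of symmetric polynomials $$D_N(u)\big|_{\Lambda_N}=\mathrm P\theta_\omega(uC_1)\,\mathrm P\theta_\omega(uC_2)\cdots\mathrm P\theta_\omega(uC_N)\big|_{\Lambda_N}$$ (product of operators in this order). 2. The operators $\mathrm P\theta_\omega(uC_i)$ do not commute in general: if $N\ge3$, then for every $\omega$ as above there are nonzero $q,t,u$ and indices $i,j$ such that $\mathrm P\theta_\omega(uC_i)\,\mathrm P\theta_\omega(uC_j)\ne \mathrm P\theta_\omega(uC_j)\,\mathrm P\theta_\omega(uC_i)$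 on $\mathbb C[x_1,\dots,x_N]$. -/

import Mathlib

open MvPolynomial

namespace DellCherednik

noncomputable section

/-! ### Convergent series of linear operators -/

section Series

variable {ι V W : Type*} [AddCommGroup V] [Module ℂ V] [AddCommGroup W] [Module ℂ W]

/-- The series `∑ T i` of linear operators `V → W` converges (unconditionally) to the operator `S`:
for every vector `f`, the series `∑ T i f` converges to `S f` after applying any linear functional
of `W`. Since all linear functionals are allowed, this says that the vectors `T i f` lie in one
finite-dimensional subspace of `W` and that their sum converges absolutely there. In particular, in
a space of polynomials it is stronger than coefficientwise convergence. -/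
def HasOpSum (T : ι → V →ₗ[ℂ] W) (S : V →ₗ[ℂ] W) : Prop :=
  ∀ (f : V) (φ : W →ₗ[ℂ] ℂ), HasSum (fun i => φ (T i f)) (φ (S f))

/-- The series `∑ T i` of linear operators converges. -/
def OpSummable (T : ι → V →ₗ[ℂ] W) : Prop := ∃ S, HasOpSum T S

/-- The sum of a series of operators is unique. -/
theorem HasOpSum.unique {T : ι → V →ₗ[ℂ] W} {S S' : V →ₗ[ℂ] W}
    (h : HasOpSum T S) (h' : HasOpSum T S') : S = S' := by
  ext f
  rw [← sub_eq_zero, ← Module.forall_dual_apply_eq_zero_iff ℂ]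
  intro φ
  rw [map_sub, sub_eq_zero]
  exact (h f φ).unique (h' f φ)

open Classical in
/-- The sum `∑ T i` of a convergent series of operators (and `0` if the series diverges). -/
def opSum (T : ι → V →ₗ[ℂ] W) : V →ₗ[ℂ] W :=
  if h : OpSummable T then h.choose else 0

theorem OpSummable.hasOpSum {T : ι → V →ₗ[ℂ] W} (h : OpSummable T) : HasOpSum T (opSum T) := by
  rw [opSum, dif_pos h]
  exact h.choose_spec

/-- The `n`-th term `ω^((n²-n)/2) (-u)^n A(q^n, t^n)` of the series `Pθ_ω(uA)(q,t)`. -/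
def PthetaTerm (ω u : ℂ) (A : ℂ → ℂ → V →ₗ[ℂ] V) (q t : ℂ) (n : ℤ) : V →ₗ[ℂ] V :=
  (ω ^ ((n ^ 2 - n) / 2) * (-u) ^ n) • A (q ^ n) (t ^ n)

/-- `Pθ_ω(uA)(q,t) = ∑_{n ∈ ℤ} ω^((n²-n)/2) (-u)^n A(q^n, t^n)`. -/
def Ptheta (ω u : ℂ) (A : ℂ → ℂ → V →ₗ[ℂ] V) (q t : ℂ) : V →ₗ[ℂ] V :=
  opSum (PthetaTerm ω u A q t)

end Series

/-! ### Operators on polynomials -/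

/-- The polynomial ring `ℂ[x_1, …, x_N]`, the variables being indexed by `Fin N`. -/
abbrev XPoly (N : ℕ) : Type := MvPolynomial (Fin N) ℂ

/-- The field of rational functions `ℂ(x_1, …, x_N)`. -/
abbrev RatFun (N : ℕ) : Type := FractionRing (XPoly N)

/-- The variable `x_i` as a rational function. -/
def rx {N : ℕ} (i : Fin N) : RatFun N := algebraMap (XPoly N) (RatFun N) (X i)

/-- A scalar as a (constant) rational function. -/
def rc {N : ℕ} (c : ℂ) : RatFun N := algebraMap (XPoly N) (RatFun N) (C c)

/-- The operator `σ_{ij}` which exchanges the variables `x_i` and `x_j`. -/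
def sigma {N : ℕ} (i j : Fin N) : XPoly N →ₐ[ℂ] XPoly N := rename (Equiv.swap i j)

/-- The operator `γ_i = q^{-x_i ∂_i}`, that is `x_i ↦ q⁻¹ x_i`, the other variables being fixed. -/
def gam {N : ℕ} (q : ℂ) (i : Fin N) : Module.End ℂ (XPoly N) :=
  (aeval (fun k : Fin N => if k = i then C q⁻¹ * X k else X k) :
    XPoly N →ₐ[ℂ] XPoly N).toLinearMap

theorem X_sub_X_dvd {N : ℕ} (i j : Fin N) (f : XPoly N) : X i - X j ∣ f - sigma i j f := by
  rw [← Ideal.mem_span_singleton, ← Ideal.Quotient.eq]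
  have key : (Ideal.Quotient.mkₐ ℂ (Ideal.span {(X i - X j : XPoly N)})) =
      (Ideal.Quotient.mkₐ ℂ (Ideal.span {(X i - X j : XPoly N)})).comp (sigma i j) := by
    refine MvPolynomial.algHom_ext fun k => ?_
    simp only [AlgHom.comp_apply, Ideal.Quotient.mkₐ_eq_mk, sigma, rename_X]
    rw [Ideal.Quotient.eq, Ideal.mem_span_singleton]
    rcases eq_or_ne k i with rfl | hi
    · rw [Equiv.swap_apply_left]
    · rcases eq_or_ne k j with rfl | hj
      · rw [Equiv.swap_apply_right]
        exact ⟨-1, by ring⟩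
      · rw [Equiv.swap_apply_of_ne_of_ne hi hj, sub_self]
        exact dvd_zero _
  exact DFunLike.congr_fun key f

theorem exists_R {N : ℕ} (t : ℂ) (i j : Fin N) (f : XPoly N) :
    ∃ g : XPoly N, (X i - X j) * g =
      (X i - C t * X j) * f + C (t - 1) * X j * sigma i j f := by
  obtain ⟨d, hd⟩ := X_sub_X_dvd i j f
  refine ⟨f - C (t - 1) * X j * d, ?_⟩
  have : C (t - 1) = (C t - 1 : XPoly N) := by rw [C_sub, C_1]
  rw [this]
  linear_combination ((C t - 1) * X j) * hd

theorem X_sub_X_ne_zero {N : ℕ} {i j : Fin N} (h : i ≠ j) : (X i - X j : XPoly N) ≠ 0 :=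
  sub_ne_zero.mpr fun e => h (X_injective e)

/-- For `i ≠ j`, the operator
`R_{ij}(t) = (x_i - t x_j)/(x_i - x_j) + ((t - 1) x_j)/(x_i - x_j) σ_{ij}`
on polynomials (see `algebraMap_R`); for `i = j`, where it is never used, the identity. -/
def R {N : ℕ} (t : ℂ) (i j : Fin N) : Module.End ℂ (XPoly N) :=
  if h : i = j then 1 else
  { toFun := fun f => (exists_R t i j f).choose
    map_add' := fun f g => by
      apply mul_left_cancel₀ (X_sub_X_ne_zero h)
      have e := (exists_R t i j (f + g)).choose_spec
      have e1 := (exists_R t i j f).choose_spec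
      have e2 := (exists_R t i j g).choose_spec
      have hs := map_add (sigma i j) f g
      linear_combination e - e1 - e2 + C (t - 1) * X j * hs
    map_smul' := fun c f => by
      apply mul_left_cancel₀ (X_sub_X_ne_zero h)
      have e := (exists_R t i j (c • f)).choose_spec
      have e1 := (exists_R t i j f).choose_spec
      have hs := map_smul (sigma i j) c f
      have hc : ∀ p : XPoly N, c • p = C c * p := fun p => smul_eq_C_mul p c
      have hf := hc f
      have hg := hc (exists_R t i j f).choose
      rw [hc (sigma i j f)] at hs
      rw [RingHom.id_apply]
      linear_combination e - C c * e1 + C (t - 1) * X j * hs + (X i - C t * X j) * hf -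
        (X i - X j) * hg }

theorem R_spec {N : ℕ} (t : ℂ) {i j : Fin N} (h : i ≠ j) (f : XPoly N) :
    (X i - X j) * R t i j f = (X i - C t * X j) * f + C (t - 1) * X j * sigma i j f := by
  rw [R, dif_neg h]
  exact (exists_R t i j f).choose_spec

/-- The defining formula of `R_{ij}(t)`, as an identity of rational functions. -/
theorem algebraMap_R {N : ℕ} (t : ℂ) {i j : Fin N} (h : i ≠ j) (f : XPoly N) :
    algebraMap (XPoly N) (RatFun N) (R t i j f) =
      (rx i - rc t * rx j) / (rx i - rx j) * algebraMap (XPoly N) (RatFun N) f +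
      (rc (t - 1) * rx j) / (rx i - rx j) * algebraMap (XPoly N) (RatFun N) (sigma i j f) := by
  have h0 : (rx i - rx j : RatFun N) ≠ 0 := by
    rw [rx, rx, ← map_sub]
    exact (map_ne_zero_iff _ (IsFractionRing.injective (XPoly N) (RatFun N))).mpr
      (X_sub_X_ne_zero h)
  have := congrArg (algebraMap (XPoly N) (RatFun N)) (R_spec t h f)
  rw [map_mul, map_add, map_mul, map_mul, map_mul, map_sub, map_sub, map_mul] at this
  simp only [rx, rc] at h0 ⊢
  rw [div_mul_eq_mul_div, div_mul_eq_mul_div, ← add_div, eq_div_iff h0]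
  linear_combination this

theorem R_mul_R_inv {N : ℕ} {t : ℂ} (ht : t ≠ 0) (i j : Fin N) : R t i j * R t⁻¹ i j = 1 := by
  rcases eq_or_ne i j with rfl | h
  · rw [R, dif_pos rfl, R, dif_pos rfl, one_mul]
  refine LinearMap.ext fun f => ?_
  have e1 := R_spec t⁻¹ h f
  have e2 := congrArg (sigma i j) e1
  have e3 := R_spec t h (R t⁻¹ i j f)
  have hs : sigma i j (sigma i j f) = f := by
    rw [sigma, rename_rename, ← Equiv.coe_trans, Equiv.swap_swap, Equiv.coe_refl, rename_id,
      AlgHom.id_apply]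
  have hi : sigma i j (X i) = (X j : XPoly N) := by simp [sigma]
  have hj : sigma i j (X j) = (X i : XPoly N) := by simp [sigma]
  have hc : ∀ c : ℂ, sigma i j (C c) = (C c : XPoly N) := fun c => by simp [sigma]
  have ht' : (C t * C t⁻¹ : XPoly N) = 1 := by rw [← C_mul, mul_inv_cancel₀ ht, C_1]
  simp only [map_mul, map_add, map_sub, hs, hi, hj, hc] at e1 e2 e3
  simp only [C_1] at e1 e2 e3
  rw [Module.End.mul_apply, Module.End.one_apply]
  apply mul_left_cancel₀ (X_sub_X_ne_zero h)
  apply mul_left_cancel₀ (X_sub_X_ne_zero h)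
  linear_combination (X i - X j) * e3 + (X i - C t * X j) * e1 - (C t - 1) * X j * e2 +
    (X j * (X j - X i) * f + X j * (X i - X j) * sigma i j f) * ht'

/-- `R_{ij}(t)` is invertible for `t ≠ 0`. -/
theorem isUnit_R {N : ℕ} {t : ℂ} (ht : t ≠ 0) (i j : Fin N) : IsUnit (R t i j) := by
  refine ⟨⟨R t i j, R t⁻¹ i j, R_mul_R_inv ht i j, ?_⟩, rfl⟩
  simpa only [inv_inv] using R_mul_R_inv (inv_ne_zero ht) i j

/-- The Cherednik operator
`C_i(t,q) = t^{i-1} R_{i,i+1}(t) ⋯ R_{iN}(t) γ_i R_{1,i}(t)⁻¹ ⋯ R_{i-1,i}(t)⁻¹`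
on `ℂ[x_1, …, x_N]`. As the index of `Fin N` starts at `0`, the exponent is `i` here. The inverse is
that of the ring of linear operators (see `isUnit_R`). -/
def cherednik {N : ℕ} (i : Fin N) (q t : ℂ) : Module.End ℂ (XPoly N) :=
  t ^ (i : ℕ) •
    ((((List.finRange N).filter (fun j => i < j)).map (fun j => R t i j)).prod *
      gam q i *
      (((List.finRange N).filter (fun j => j < i)).map (fun j => Ring.inverse (R t j i))).prod)

/-! ### The generating function of the Dell Hamiltonians -/

/-- The coefficient `∏_{i<j} (t^{n_j} x_i - t^{n_i} x_j)/(x_i - x_j)`. -/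
def dellCoeff {N : ℕ} (t : ℂ) (n : Fin N → ℤ) : RatFun N :=
  ∏ i : Fin N, ∏ j ∈ Finset.Ioi i,
    (rc (t ^ n j) * rx i - rc (t ^ n i) * rx j) / (rx i - rx j)

/-- The term of index `(n_1, …, n_N)` of the series `D_N(u)`, where `γ_i^{n_i}` is
`q^{-n_i x_i ∂_i}`. -/
def dellTerm (N : ℕ) (ω u q t : ℂ) (n : Fin N → ℤ) : XPoly N →ₗ[ℂ] RatFun N :=
  (ω ^ (∑ i, (n i ^ 2 - n i) / 2) * (-u) ^ (∑ i, n i)) •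
    (LinearMap.mulLeft ℂ (dellCoeff t n) ∘ₗ
      (IsScalarTower.toAlgHom ℂ (XPoly N) (RatFun N)).toLinearMap ∘ₗ
      (List.ofFn fun i : Fin N => gam (q ^ n i) i).prod)

/-- The generating function
`D_N(u) = ∑_{n_1,…,n_N ∈ ℤ} ω^{∑ (n_i²-n_i)/2} (-u)^{∑ n_i}
  ∏_{i<j} (t^{n_j} x_i - t^{n_i} x_j)/(x_i - x_j) ∏ γ_i^{n_i}`,
as an operator from polynomials to rational functions. -/
def dell (N : ℕ) (ω u q t : ℂ) : XPoly N →ₗ[ℂ] RatFun N :=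
  opSum (dellTerm N ω u q t)

end

end DellCherednik

open DellCherednik

/-!
The convergence statements hold because every family of operators in sight is an *exponential
family*: applied to a vector, its value at `n` is a finite sum of terms `χ(n) g` with characters `χ`
and fixed vectors `g` (`cherednik_mem_expFam`, `dellTerm_mem_expFam`), and the theta weight
decreases fast enough to be summable against every character (`rapidlyDecreasing_thetaWeight`). By
Fubini, the product of the operators `Pθ_ω(uC_i)` is then the sum over `n ∈ ℤ^N` of the products of
the `C_i(q^{n_i}, t^{n_i})` (`hasOpSum_list_prod`).

As the weight is invariant under permutations of `n`, the two sums over `ℤ^N` agree as soon as their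
summands agree after symmetrisation in `n` (`eq_of_sum_perm_eq`), which is a finite identity
(`sum_perm_cherednik_eq`). On a symmetric polynomial the inverses in the Cherednik operators act as
the identity and the `γ_i` can be moved to the right (`cherednik_prod_drop`). What remains is the
product of the chains `R_{k,k+1} ⋯ R_{kN}`, which is handled one chain at a time, starting from the
last one (`symmSum_chain_eq`). A chain acts on a function symmetric in the later variables as an
explicit combination of the exchanges `σ_{kj}` (`algebraMap_chain`). After symmetrisation an
exchange of variables becomes an exchange of exponents, and the coefficients add up to those of
`D_N` by Lagrange interpolation of `∏ (z - x_i)` at the nodes `x_j / t^{n_j}`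
(`sum_chainCoeff_mul_partialCoeff`).

Already in degree one the operators fail to commute. On the span of `x_1`, `x_2` and `x_3 + ⋯ + x_N`
the first two operators are triangular, with entries that are combinations of values of
`θ_ω(z) = ∑ ω^((n²-n)/2) (-z)^n`. For `t = -1` one entry of their commutator factors into
differences of even and odd parts of `θ_ω`, and is nonzero for suitable `q` and `u` by the
quasi-periodicity of `θ_ω` (`exists_theta_parts`).
-/

namespace DellCherednik

noncomputable section

/-! ### Exponential families and rapidly decreasing weights -/

section ExpFam

variable {A B V W : Type*} [AddCommGroup A] [AddCommGroup B]
  [AddCommGroup V] [Module ℂ V] [AddCommGroup W] [Module ℂ W]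

/-- The exponential families `A → W`: the finite sums `n ↦ ∑ χ(n) g` with characters
`χ : A → ℂˣ` and vectors `g`. Characters are encoded as monoid homomorphisms
`Multiplicative A →* ℂ`; their values are automatically nonzero. -/
def expFam (A W : Type*) [AddCommGroup A] [AddCommGroup W] [Module ℂ W] :
    Submodule ℂ (A → W) :=
  Submodule.span ℂ {F | ∃ (χ : Multiplicative A →* ℂ) (g : W),
    F = fun n => χ (Multiplicative.ofAdd n) • g}

theorem char_smul_mem_expFam (χ : Multiplicative A →* ℂ) (g : W) :
    (fun n => χ (Multiplicative.ofAdd n) • g) ∈ expFam A W :=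
  Submodule.subset_span ⟨χ, g, rfl⟩

theorem const_mem_expFam (g : W) : (fun _ : A => g) ∈ expFam A W := by
  simpa using char_smul_mem_expFam (A := A) 1 g

/-- The character `n ↦ z ^ n` of `ℤ`, for `z ≠ 0`. -/
def zpowChar (z : ℂ) (hz : z ≠ 0) : Multiplicative ℤ →* ℂ where
  toFun n := z ^ n.toAdd
  map_one' := by simp
  map_mul' a b := by simp [zpow_add₀ hz]

theorem zpow_smul_mem_expFam {z : ℂ} (hz : z ≠ 0) (g : W) :
    (fun n : ℤ => z ^ n • g) ∈ expFam ℤ W :=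
  char_smul_mem_expFam (zpowChar z hz) g

/-- A linear map between spaces of families preserves exponential families as soon as it sends the
families with a single term to exponential families. -/
theorem map_mem_expFam_of_generators (L : (B → V) →ₗ[ℂ] (A → W))
    (hL : ∀ (χ : Multiplicative B →* ℂ) (g : V),
      L (fun n => χ (Multiplicative.ofAdd n) • g) ∈ expFam A W)
    {F : B → V} (hF : F ∈ expFam B V) : L F ∈ expFam A W := by
  have h : expFam B V ≤ (expFam A W).comap L := by
    refine Submodule.span_le.mpr ?_
    rintro _ ⟨χ, g, rfl⟩
    exact hL χ g
  exact h hF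

theorem expFam_comp_addHom {F : B → W} (hF : F ∈ expFam B W) (e : A →+ B) :
    (fun n => F (e n)) ∈ expFam A W :=
  map_mem_expFam_of_generators (LinearMap.funLeft ℂ W e)
    (fun χ g => char_smul_mem_expFam (χ.comp (AddMonoidHom.toMultiplicative e)) g) hF

theorem char_smul_expFam_mem {F : A → W} (hF : F ∈ expFam A W) (χ : Multiplicative A →* ℂ) :
    (fun n => χ (Multiplicative.ofAdd n) • F n) ∈ expFam A W := by
  refine map_mem_expFam_of_generators
    (LinearMap.pi fun n : A => χ (Multiplicative.ofAdd n) •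
      (LinearMap.proj n : (A → W) →ₗ[ℂ] W)) (fun ψ g => ?_) hF
  convert char_smul_mem_expFam (χ * ψ) g using 2 with n
  simp [smul_smul]

/-- If `T n f` is an exponential family for each vector `f`, then `T n` also maps exponential
families to exponential families. -/
theorem apply_mem_expFam {T : A → V →ₗ[ℂ] W} (hT : ∀ f, (fun n => T n f) ∈ expFam A W)
    {F : A → V} (hF : F ∈ expFam A V) : (fun n => T n (F n)) ∈ expFam A W := by
  refine map_mem_expFam_of_generators
    (LinearMap.pi fun n => T n ∘ₗ LinearMap.proj n) (fun ψ g => ?_) hF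
  convert char_smul_expFam_mem (hT g) ψ using 2 with n
  simp

theorem map_mem_expFam {F : A → V} (hF : F ∈ expFam A V) (T : V →ₗ[ℂ] W) :
    (fun n => T (F n)) ∈ expFam A W :=
  apply_mem_expFam (T := fun _ => T) (fun f => const_mem_expFam (T f)) hF

theorem list_prod_apply_mem_expFam {ι : Type*} (T : ι → A → Module.End ℂ V)
    (hT : ∀ i f, (fun n => T i n f) ∈ expFam A V) (l : List ι) (f : V) :
    (fun n => (l.map fun i => T i n).prod f) ∈ expFam A V := by
  induction l with
  | nil => simpa using const_mem_expFam f
  | cons i l ih =>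
    simp only [List.map_cons, List.prod_cons, Module.End.mul_apply]
    exact apply_mem_expFam (hT i) ih

theorem mul_mem_expFam {K : Type*} [CommRing K] [Algebra ℂ K] {F G : A → K}
    (hF : F ∈ expFam A K) (hG : G ∈ expFam A K) : (fun n => F n * G n) ∈ expFam A K := by
  have h (g : K) : (fun n => LinearMap.mul ℂ K (F n) g) ∈ expFam A K :=
    map_mem_expFam hF ((LinearMap.mul ℂ K).flip g)
  exact apply_mem_expFam (T := fun n => LinearMap.mul ℂ K (F n)) h hG

theorem prod_mem_expFam {K : Type*} [CommRing K] [Algebra ℂ K] {ι : Type*} (s : Finset ι)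
    {F : ι → A → K} (hF : ∀ i ∈ s, F i ∈ expFam A K) :
    (fun n => ∏ i ∈ s, F i n) ∈ expFam A K := by
  classical
  induction s using Finset.induction_on with
  | empty => simpa using const_mem_expFam (1 : K)
  | insert i s hi ih =>
    simp only [Finset.prod_insert hi]
    exact mul_mem_expFam (hF i (Finset.mem_insert_self i s))
      (ih fun j hj => hF j (Finset.mem_insert_of_mem hj))

/-- A weight on `A` which decreases so rapidly that it is summable against every character. -/
def RapidlyDecreasing (w : A → ℂ) : Prop :=
  ∀ χ : Multiplicative A →* ℂ, Summable fun n => w n * χ (Multiplicative.ofAdd n)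

/-- An exponential family multiplied by a rapidly decreasing weight has a weak sum: it has finitely
many terms, and each of them is a scalar series times a fixed vector. -/
theorem RapidlyDecreasing.exists_hasSum {w : A → ℂ} (hw : RapidlyDecreasing w) {F : A → W}
    (hF : F ∈ expFam A W) :
    ∃ s : W, ∀ φ : W →ₗ[ℂ] ℂ, HasSum (fun n => φ (w n • F n)) (φ s) := by
  rw [expFam] at hF
  induction hF using Submodule.span_induction with
  | mem F h =>
    obtain ⟨χ, g, rfl⟩ := h
    refine ⟨(∑' n, w n * χ (Multiplicative.ofAdd n)) • g, fun φ => ?_⟩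
    simpa only [smul_smul, map_smul, smul_eq_mul] using (hw χ).hasSum.mul_right (φ g)
  | zero => exact ⟨0, fun φ => by simp [hasSum_zero]⟩
  | add F G _ _ h1 h2 =>
    obtain ⟨s, hs⟩ := h1
    obtain ⟨s', hs'⟩ := h2
    refine ⟨s + s', fun φ => ?_⟩
    simpa only [Pi.add_apply, smul_add, map_add] using (hs φ).add (hs' φ)
  | smul c F _ h =>
    obtain ⟨s, hs⟩ := h
    refine ⟨c • s, fun φ => ?_⟩
    simpa only [Pi.smul_apply, smul_comm _ c, map_smul, smul_eq_mul] using (hs φ).mul_left c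

/-- A weak sum of vectors is unique. -/
theorem eq_of_forall_hasSum {ι : Type*} {F : ι → W} {s s' : W}
    (h : ∀ φ : W →ₗ[ℂ] ℂ, HasSum (fun n => φ (F n)) (φ s))
    (h' : ∀ φ : W →ₗ[ℂ] ℂ, HasSum (fun n => φ (F n)) (φ s')) : s = s' := by
  rw [← sub_eq_zero, ← Module.forall_dual_apply_eq_zero_iff ℂ]
  intro φ
  rw [map_sub, sub_eq_zero]
  exact (h φ).unique (h' φ)

/-- A series of operators converges as soon as it converges on every vector: the sum is linear
since weak sums are unique. -/
theorem opSummable_of_forall {ι : Type*} {T : ι → V →ₗ[ℂ] W}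
    (h : ∀ f, ∃ s : W, ∀ φ : W →ₗ[ℂ] ℂ, HasSum (fun n => φ (T n f)) (φ s)) : OpSummable T := by
  choose S hS using h
  refine ⟨{ toFun := S, map_add' := fun f g => ?_, map_smul' := fun c f => ?_ }, hS⟩
  · refine eq_of_forall_hasSum (hS (f + g)) fun φ => ?_
    simpa only [map_add] using (hS f φ).add (hS g φ)
  · refine eq_of_forall_hasSum (hS (c • f)) fun φ => ?_
    simpa only [map_smul, smul_eq_mul, RingHom.id_apply] using (hS f φ).mul_left c

theorem RapidlyDecreasing.opSummable {w : A → ℂ} (hw : RapidlyDecreasing w)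
    {T : A → V →ₗ[ℂ] W} (hT : ∀ f, (fun n => T n f) ∈ expFam A W) :
    OpSummable fun n => w n • T n :=
  opSummable_of_forall fun f => hw.exists_hasSum (hT f)

end ExpFam

/-! ### The theta weight -/

theorem two_mul_half_sq_sub (n : ℤ) : 2 * ((n ^ 2 - n) / 2) = n ^ 2 - n := by
  have h : Even (n ^ 2 - n) := by
    have := Int.even_mul_pred_self n
    rwa [mul_sub, mul_one, ← sq] at this
  exact Int.mul_ediv_cancel' h.two_dvd

/-- The substitution `ω = exp (2πiτ)` turns the series into that of a Jacobi theta function. -/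
theorem summable_theta {ω : ℂ} (h0 : ω ≠ 0) (h1 : ‖ω‖ < 1) {z : ℂ} (hz : z ≠ 0) :
    Summable fun n : ℤ => ω ^ ((n ^ 2 - n) / 2) * z ^ n := by
  have hpi : (2 * Real.pi * Complex.I : ℂ) ≠ 0 := Complex.two_pi_I_ne_zero
  have him : 0 < (Complex.log ω / (2 * Real.pi * Complex.I)).im := by
    have h : Complex.log ω / (2 * Real.pi * Complex.I) =
        -(Complex.log ω * Complex.I) * ((2 * Real.pi)⁻¹ : ℝ) := by
      have hp : (Real.pi : ℂ) ≠ 0 := by exact_mod_cast Real.pi_ne_zero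
      push_cast
      field_simp
      rw [Complex.I_sq]
      ring
    rw [h, Complex.im_mul_ofReal]
    have : (-(Complex.log ω * Complex.I)).im = -Real.log ‖ω‖ := by simp [Complex.log_re]
    rw [this]
    have hl := Real.log_neg (norm_pos_iff.mpr h0) h1
    have := Real.pi_pos
    exact mul_pos (neg_pos.mpr hl) (by positivity)
  have key := (summable_jacobiTheta₂_term_iff
    ((Complex.log z - Complex.log ω / 2) / (2 * Real.pi * Complex.I)) _).mpr him
  refine key.congr fun n => ?_
  have hh : (((n ^ 2 - n) / 2 : ℤ) : ℂ) = ((n : ℂ) ^ 2 - n) / 2 := by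
    have := two_mul_half_sq_sub n
    rw [eq_div_iff two_ne_zero, mul_comm]
    exact_mod_cast this
  rw [jacobiTheta₂_term]
  have hω : ω ^ ((n ^ 2 - n) / 2) = Complex.exp (((n : ℂ) ^ 2 - n) / 2 * Complex.log ω) := by
    rw [← hh, Complex.exp_int_mul, Complex.exp_log h0]
  have hz' : z ^ n = Complex.exp (n * Complex.log z) := by
    rw [Complex.exp_int_mul, Complex.exp_log hz]
  rw [hω, hz', ← Complex.exp_add]
  congr 1
  field_simp
  ring

/-- The coefficient `ω^((n²-n)/2) (-u)^n` of the series `Pθ_ω`. -/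
def thetaWeight (ω u : ℂ) (n : ℤ) : ℂ := ω ^ ((n ^ 2 - n) / 2) * (-u) ^ n

/-- Every character of `ℤ` is of the form `n ↦ z ^ n` with `z ≠ 0`. -/
theorem char_int_eq_zpow (χ : Multiplicative ℤ →* ℂ) :
    χ (Multiplicative.ofAdd 1) ≠ 0 ∧
      ∀ n : ℤ, χ (Multiplicative.ofAdd n) = χ (Multiplicative.ofAdd 1) ^ n := by
  have h1 : χ (Multiplicative.ofAdd 1) ≠ 0 := by
    intro h
    have := map_mul χ (Multiplicative.ofAdd 1) (Multiplicative.ofAdd (-1))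
    rw [h, zero_mul, ← ofAdd_add] at this
    simp at this
  refine ⟨h1, fun n => ?_⟩
  have := congrArg Units.val (map_zpow χ.toHomUnits (Multiplicative.ofAdd (1 : ℤ)) n)
  rw [← ofAdd_zsmul] at this
  simpa using this

theorem rapidlyDecreasing_thetaWeight {ω u : ℂ} (h0 : ω ≠ 0) (h1 : ‖ω‖ < 1) (hu : u ≠ 0) :
    RapidlyDecreasing (thetaWeight ω u) := by
  intro χ
  obtain ⟨hz, hχ⟩ := char_int_eq_zpow χ
  refine (summable_theta h0 h1 (mul_ne_zero (neg_ne_zero.mpr hu) hz)).congr fun n => ?_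
  rw [hχ n, thetaWeight, mul_zpow, mul_assoc]

/-- A character of `ℤ^N` is a product of characters of `ℤ`, so a product of rapidly decreasing
weights is rapidly decreasing. -/
theorem RapidlyDecreasing.pi {w : ℤ → ℂ} (hw : RapidlyDecreasing w) (N : ℕ) :
    RapidlyDecreasing fun n : Fin N → ℤ => ∏ i, w (n i) := by
  induction N with
  | zero => exact fun χ => Summable.of_finite
  | succ N ih =>
    intro χ
    let e₁ : ℤ →+ (Fin (N + 1) → ℤ) :=
      { toFun := fun a => Fin.cons a 0
        map_zero' := by ext i; refine Fin.cases ?_ (fun _ => ?_) i <;> simp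
        map_add' := fun a b => by ext i; refine Fin.cases ?_ (fun _ => ?_) i <;> simp }
    let e₂ : (Fin N → ℤ) →+ (Fin (N + 1) → ℤ) :=
      { toFun := fun a => Fin.cons 0 a
        map_zero' := by ext i; refine Fin.cases ?_ (fun _ => ?_) i <;> simp
        map_add' := fun a b => by ext i; refine Fin.cases ?_ (fun _ => ?_) i <;> simp }
    have h := summable_mul_of_summable_norm
      (hw (χ.comp (AddMonoidHom.toMultiplicative e₁))).norm
      (ih (χ.comp (AddMonoidHom.toMultiplicative e₂))).norm
    rw [← (Fin.consEquiv fun _ : Fin (N + 1) => ℤ).summable_iff]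
    refine h.congr fun p => ?_
    have hp : (Fin.consEquiv fun _ : Fin (N + 1) => ℤ) p = e₁ p.1 + e₂ p.2 := by
      ext i; refine Fin.cases ?_ (fun _ => ?_) i <;> simp [e₁, e₂, Fin.consEquiv]
    have hχ : χ (Multiplicative.ofAdd ((Fin.consEquiv fun _ : Fin (N + 1) => ℤ) p)) =
        χ (Multiplicative.ofAdd (e₁ p.1)) * χ (Multiplicative.ofAdd (e₂ p.2)) := by
      rw [hp, ofAdd_add, map_mul]
    rw [Function.comp_apply, hχ]
    simp only [Fin.prod_univ_succ]
    simp only [MonoidHom.comp_apply, AddMonoidHom.toMultiplicative_apply_apply, toAdd_ofAdd,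
      Fin.consEquiv, Equiv.coe_fn_mk, Fin.cons_zero, Fin.cons_succ]
    ring

theorem prod_thetaWeight {N : ℕ} {ω u : ℂ} (h0 : ω ≠ 0) (hu : u ≠ 0) (n : Fin N → ℤ) :
    ∏ i, thetaWeight ω u (n i) = ω ^ (∑ i, (n i ^ 2 - n i) / 2) * (-u) ^ (∑ i, n i) := by
  have h : ∀ (z : ℂ), z ≠ 0 → ∀ (s : Finset (Fin N)) (m : Fin N → ℤ),
      ∏ i ∈ s, z ^ m i = z ^ ∑ i ∈ s, m i := by
    intro z hz s m
    induction s using Finset.induction_on with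
    | empty => simp
    | insert i s hi ih => rw [Finset.prod_insert hi, Finset.sum_insert hi, zpow_add₀ hz, ih]
  simp only [thetaWeight]
  rw [Finset.prod_mul_distrib, h ω h0, h (-u) (neg_ne_zero.mpr hu)]

/-! ### Products of series of operators -/

/-- The product of finitely many convergent series of exponential families of operators is the
sum of the products of the terms. -/
theorem hasOpSum_list_prod {V : Type*} [AddCommGroup V] [Module ℂ V] {w : ℤ → ℂ}
    (hw : RapidlyDecreasing w) {N : ℕ} (T : Fin N → ℤ → Module.End ℂ V)
    (hT : ∀ i f, (fun n => T i n f) ∈ expFam ℤ V) (S : Fin N → Module.End ℂ V)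
    (hS : ∀ i, HasOpSum (fun n => w n • T i n) (S i)) :
    HasOpSum (fun n : Fin N → ℤ => (∏ i, w (n i)) • (List.ofFn fun i => T i (n i)).prod)
      (List.ofFn S).prod := by
  induction N with
  | zero =>
    intro f φ
    simp
  | succ N ih =>
    intro f φ
    have hfam : (fun n : Fin (N + 1) → ℤ => (List.ofFn fun i => T i (n i)).prod f) ∈
        expFam (Fin (N + 1) → ℤ) V := by
      have := list_prod_apply_mem_expFam (A := Fin (N + 1) → ℤ) (fun i n => T i (n i))
        (fun i f => expFam_comp_addHom (hT i f)
          (Pi.evalAddMonoidHom (fun _ : Fin (N + 1) => ℤ) i)) (List.finRange _) f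
      simpa only [List.ofFn_eq_map] using this
    obtain ⟨s, hs⟩ := (hw.pi (N + 1)).exists_hasSum hfam
    have h1 := (Fin.consEquiv fun _ : Fin (N + 1) => ℤ).hasSum_iff.mpr (hs φ)
    have h2 := h1.prod_fiberwise (g := fun a =>
      (φ ∘ₗ (w a • T 0 a)) ((List.ofFn fun i => S i.succ).prod f)) (fun a => by
        convert ih (fun i => T i.succ) (fun i => hT i.succ) (fun i => S i.succ)
          (fun i => hS i.succ) f (φ ∘ₗ (w a • T 0 a)) using 2 with m
        simp only [Function.comp_apply, Fin.consEquiv, Equiv.coe_fn_mk, Fin.prod_univ_succ,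
          Fin.cons_zero, Fin.cons_succ, List.ofFn_succ, List.prod_cons, LinearMap.comp_apply,
          LinearMap.smul_apply, Module.End.mul_apply, map_smul, smul_eq_mul]
        ring)
    have h3 := hS 0 ((List.ofFn fun i => S i.succ).prod f) φ
    have h4 : φ s = φ ((List.ofFn S).prod f) := by
      rw [h2.unique h3, List.ofFn_succ, List.prod_cons, Module.End.mul_apply]
    rw [← h4]
    exact hs φ

/-! ### The operators `R`, `γ` and the Cherednik operators -/

section Operators

variable {N : ℕ}

theorem R_eq_of_mul_eq {t : ℂ} {i j : Fin N} (h : i ≠ j) {f g : XPoly N}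
    (e : (X i - X j) * g = (X i - C t * X j) * f + C (t - 1) * X j * sigma i j f) :
    R t i j f = g :=
  mul_left_cancel₀ (X_sub_X_ne_zero h) ((R_spec t h f).trans e.symm)

/-- `R t` is an affine function of `t`, with `R 1 = 1`. -/
theorem R_affine (t : ℂ) (i j : Fin N) (f : XPoly N) :
    R t i j f = R 0 i j f + t • (f - R 0 i j f) := by
  rcases eq_or_ne i j with rfl | h
  · simp [R]
  · apply R_eq_of_mul_eq h
    have e := R_spec 0 h f
    simp only [smul_eq_C_mul, C_sub, C_0, C_1] at e ⊢
    linear_combination (1 - C t) * e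

theorem R_of_sigma_eq (t : ℂ) {i j : Fin N} {f : XPoly N} (hf : sigma i j f = f) :
    R t i j f = f := by
  rcases eq_or_ne i j with rfl | h
  · simp [R]
  · apply R_eq_of_mul_eq h
    rw [hf, C_sub, C_1]
    ring

theorem inverse_R {t : ℂ} (ht : t ≠ 0) (i j : Fin N) : Ring.inverse (R t i j) = R t⁻¹ i j := by
  have h := R_mul_R_inv ht i j
  calc Ring.inverse (R t i j) = Ring.inverse (R t i j) * (R t i j * R t⁻¹ i j) := by
        rw [h, mul_one]
    _ = R t⁻¹ i j := by rw [← mul_assoc, Ring.inverse_mul_cancel _ (isUnit_R ht i j), one_mul]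

/-- `R_{ij}(t)` commutes with every algebra endomorphism which fixes `x_i` and `x_j` and commutes
with the exchange `σ_{ij}`. -/
theorem map_R (φ : XPoly N →ₐ[ℂ] XPoly N) (t : ℂ) {i j : Fin N} (hi : φ (X i) = X i)
    (hj : φ (X j) = X j) (hσ : ∀ f, φ (sigma i j f) = sigma i j (φ f)) (f : XPoly N) :
    φ (R t i j f) = R t i j (φ f) := by
  rcases eq_or_ne i j with rfl | h
  · simp [R]
  · refine (R_eq_of_mul_eq h ?_).symm
    have hC : ∀ c, φ (C c) = C c := fun c => φ.commutes c
    have e := congrArg φ (R_spec t h f)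
    simpa only [map_mul, map_add, map_sub φ, hi, hj, hσ, hC] using e

theorem sigma_R_of_ne (t : ℂ) {a b i j : Fin N} (hai : a ≠ i) (haj : a ≠ j) (hbi : b ≠ i)
    (hbj : b ≠ j) (f : XPoly N) : sigma a b (R t i j f) = R t i j (sigma a b f) := by
  refine map_R _ t ?_ ?_ (fun f => ?_) f
  · rw [sigma, rename_X, Equiv.swap_apply_of_ne_of_ne hai.symm hbi.symm]
  · rw [sigma, rename_X, Equiv.swap_apply_of_ne_of_ne haj.symm hbj.symm]
  · simp only [sigma, rename_rename]
    congr 2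
    have : Equiv.swap a b * Equiv.swap i j = Equiv.swap i j * Equiv.swap a b := by
      rw [Equiv.swap_mul_eq_mul_swap, Equiv.swap_inv, Equiv.swap_apply_of_ne_of_ne hai haj,
        Equiv.swap_apply_of_ne_of_ne hbi hbj]
    exact congrArg DFunLike.coe this

/-- The scaling `x_i ↦ c_i x_i` of all variables. -/
def scale (c : Fin N → ℂ) : XPoly N →ₐ[ℂ] XPoly N := aeval fun k => C (c k) * X k

theorem scale_X (c : Fin N → ℂ) (k : Fin N) : scale c (X k) = C (c k) * X k := by
  simp [scale]

theorem scale_scale (c d : Fin N → ℂ) (f : XPoly N) :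
    scale c (scale d f) = scale (fun k => d k * c k) f := by
  have : (scale c).comp (scale d) = scale (fun k => d k * c k) := by
    refine algHom_ext fun k => ?_
    have hC : scale c (C (d k)) = C (d k) := (scale c).commutes (d k)
    rw [AlgHom.comp_apply, scale_X, scale_X, map_mul, hC, scale_X, C_mul]
    ring
  exact DFunLike.congr_fun this f

theorem rename_scale (w : Equiv.Perm (Fin N)) (c : Fin N → ℂ) (f : XPoly N) :
    rename w (scale (fun k => c (w k)) f) = scale c (rename w f) := by
  have : (rename w).comp (scale (fun k => c (w k))) = (scale c).comp (rename w) := by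
    refine algHom_ext fun k => ?_
    simp only [AlgHom.comp_apply, scale_X, map_mul, rename_X, rename_C]
  exact DFunLike.congr_fun this f

theorem gam_eq_scale (q : ℂ) (i : Fin N) (f : XPoly N) :
    gam q i f = scale (fun k => if k = i then q⁻¹ else 1) f := by
  rw [gam, scale, AlgHom.toLinearMap_apply]
  congr 2
  ext1 k
  split_ifs <;> simp

/-- The product of the operators `γ_i` in any order is a scaling of the variables. -/
theorem list_prod_gam (q : Fin N → ℂ) (l : List (Fin N)) (hl : l.Nodup) (f : XPoly N) :
    (l.map fun i => gam (q i) i).prod f = scale (fun k => if k ∈ l then (q k)⁻¹ else 1) f := by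
  induction l with
  | nil =>
    have : scale (fun k : Fin N => if k ∈ ([] : List (Fin N)) then (q k)⁻¹ else 1) =
        AlgHom.id ℂ _ := by
      refine algHom_ext fun k => ?_
      simp [scale_X]
    rw [this]
    simp
  | cons i l ih =>
    rw [List.nodup_cons] at hl
    rw [List.map_cons, List.prod_cons, Module.End.mul_apply, ih hl.2, gam_eq_scale, scale_scale]
    congr 2
    ext1 k
    by_cases hk : k = i
    · subst hk
      simp [hl.1]
    · simp [hk]

/-- On a symmetric polynomial, permuting the variables after the scaling `∏ γ_i^{n_i}` amounts to
permuting the exponents `n_i`. -/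
theorem rename_ofFn_gam_prod (q : ℂ) (n : Fin N → ℤ) (w : Equiv.Perm (Fin N)) (f : XPoly N)
    (hf : f.IsSymmetric) :
    rename w ((List.ofFn fun i => gam (q ^ (n ∘ w) i) i).prod f) =
      (List.ofFn fun i => gam (q ^ n i) i).prod f := by
  have h (m : Fin N → ℤ) : (List.ofFn fun i => gam (q ^ m i) i).prod f =
      scale (fun k => (q ^ m k)⁻¹) f := by
    rw [List.ofFn_eq_map, list_prod_gam (fun i => q ^ m i) _ (List.nodup_finRange N)]
    simp
  rw [h, h]
  exact (rename_scale w (fun k => (q ^ n k)⁻¹) f).trans (by rw [hf w])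

theorem sigma_gam_of_ne (q : ℂ) {k a b : Fin N} (ha : a ≠ k) (hb : b ≠ k) (f : XPoly N) :
    sigma a b (gam q k f) = gam q k (sigma a b f) := by
  have hc : (fun l : Fin N => if Equiv.swap a b l = k then q⁻¹ else 1) =
      fun l => if l = k then q⁻¹ else 1 := by
    funext l
    have : Equiv.swap a b l = k ↔ l = k := by
      rw [Equiv.swap_apply_eq_iff, Equiv.swap_apply_of_ne_of_ne ha.symm hb.symm]
    simp only [this]
  have h := rename_scale (Equiv.swap a b) (fun l => if l = k then q⁻¹ else 1) f
  rw [hc] at h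
  rw [gam_eq_scale, gam_eq_scale]
  exact h

theorem gam_R_of_ne (q t : ℂ) {k i j : Fin N} (hi : i ≠ k) (hj : j ≠ k) (f : XPoly N) :
    gam q k (R t i j f) = R t i j (gam q k f) := by
  have h := map_R (scale fun l => if l = k then q⁻¹ else 1) t (i := i) (j := j)
    (by simp [scale_X, hi]) (by simp [scale_X, hj]) (fun f => by
      rw [← gam_eq_scale, ← gam_eq_scale, sigma_gam_of_ne q hi hj]) f
  rwa [← gam_eq_scale, ← gam_eq_scale] at h

theorem R_mem_expFam {t : ℂ} (ht : t ≠ 0) (i j : Fin N) (f : XPoly N) :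
    (fun n : ℤ => R (t ^ n) i j f) ∈ expFam ℤ (XPoly N) := by
  rw [funext fun n : ℤ => R_affine (t ^ n) i j f]
  exact add_mem (const_mem_expFam _) (zpow_smul_mem_expFam ht _)

theorem gam_mem_expFam {q : ℂ} (hq : q ≠ 0) (i : Fin N) (f : XPoly N) :
    (fun n : ℤ => gam (q ^ n) i f) ∈ expFam ℤ (XPoly N) := by
  simp only [gam_eq_scale]
  induction f using MvPolynomial.induction_on with
  | C a =>
    have (c : Fin N → ℂ) : scale c (C a) = C a := (scale c).commutes a
    simp only [this]
    exact const_mem_expFam _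
  | add f g hf hg =>
    simp only [map_add]
    exact add_mem hf hg
  | mul_X f k hf =>
    simp only [map_mul, scale_X]
    refine mul_mem_expFam hf ?_
    split_ifs
    · simp only [← smul_eq_C_mul, ← inv_zpow]
      exact zpow_smul_mem_expFam (inv_ne_zero hq) _
    · exact const_mem_expFam _

theorem cherednik_mem_expFam {q t : ℂ} (hq : q ≠ 0) (ht : t ≠ 0) (i : Fin N) (f : XPoly N) :
    (fun n : ℤ => cherednik i (q ^ n) (t ^ n) f) ∈ expFam ℤ (XPoly N) := by
  have h1 := list_prod_apply_mem_expFam (fun j (n : ℤ) => R (t ^ n) i j)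
    (fun j f => R_mem_expFam ht i j f)
  have h2 := list_prod_apply_mem_expFam (fun j (n : ℤ) => Ring.inverse (R (t ^ n) j i))
    (fun j f => by
      simp only [inverse_R (zpow_ne_zero _ ht), ← inv_zpow]
      exact R_mem_expFam (inv_ne_zero ht) j i f)
  have h3 := char_smul_expFam_mem (apply_mem_expFam (h1 ((List.finRange N).filter (i < ·)))
    (apply_mem_expFam (T := fun n : ℤ => gam (q ^ n) i) (gam_mem_expFam hq i)
      (h2 ((List.finRange N).filter (· < i)) f)))
    (zpowChar (t ^ (i : ℕ)) (pow_ne_zero _ ht))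
  refine (congrArg (· ∈ expFam ℤ (XPoly N)) (funext fun n => ?_)).mp h3
  rw [cherednik, LinearMap.smul_apply, Module.End.mul_apply, Module.End.mul_apply]
  congr 1
  simp [zpowChar, ← zpow_natCast, ← zpow_mul, mul_comm]

theorem rc_eq_algebraMap (c : ℂ) : (rc c : RatFun N) = algebraMap ℂ (RatFun N) c :=
  (IsScalarTower.algebraMap_apply ℂ (XPoly N) (RatFun N) c).symm

theorem dellCoeff_mem_expFam {t : ℂ} (ht : t ≠ 0) :
    (fun n : Fin N → ℤ => dellCoeff t n) ∈ expFam (Fin N → ℤ) (RatFun N) := by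
  have h (j : Fin N) (g : RatFun N) :
      (fun n : Fin N → ℤ => rc (t ^ n j) * g) ∈ expFam (Fin N → ℤ) (RatFun N) := by
    have := expFam_comp_addHom (zpow_smul_mem_expFam ht g)
      (Pi.evalAddMonoidHom (fun _ : Fin N => ℤ) j)
    simpa only [Algebra.smul_def, ← rc_eq_algebraMap, Pi.evalAddMonoidHom_apply] using this
  unfold dellCoeff
  refine prod_mem_expFam _ fun i _ => prod_mem_expFam _ fun j _ => ?_
  have h3 := map_mem_expFam (sub_mem (h j (rx i)) (h i (rx j)))
    (LinearMap.mulRight ℂ ((rx i - rx j : RatFun N)⁻¹))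
  simpa only [div_eq_mul_inv, Pi.sub_apply, LinearMap.mulRight_apply] using h3

theorem dellTerm_eq {ω u q t : ℂ} (hω : ω ≠ 0) (hu : u ≠ 0) (n : Fin N → ℤ) (f : XPoly N) :
    dellTerm N ω u q t n f = (∏ i, thetaWeight ω u (n i)) •
      (dellCoeff t n * algebraMap (XPoly N) (RatFun N)
        ((List.ofFn fun i : Fin N => gam (q ^ n i) i).prod f)) := by
  rw [prod_thetaWeight hω hu]
  rfl

theorem dellTerm_mem_expFam {q t : ℂ} (hq : q ≠ 0) (ht : t ≠ 0) (f : XPoly N) :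
    (fun n : Fin N → ℤ => dellCoeff t n * algebraMap (XPoly N) (RatFun N)
        ((List.ofFn fun i : Fin N => gam (q ^ n i) i).prod f)) ∈
      expFam (Fin N → ℤ) (RatFun N) := by
  have := list_prod_apply_mem_expFam (A := Fin N → ℤ) (fun i n => gam (q ^ n i) i)
    (fun i f => expFam_comp_addHom (gam_mem_expFam hq i f)
      (Pi.evalAddMonoidHom (fun _ : Fin N => ℤ) i)) (List.finRange _) f
  simp only [List.ofFn_eq_map]
  exact mul_mem_expFam (dellCoeff_mem_expFam ht) (map_mem_expFam this
    (IsScalarTower.toAlgHom ℂ (XPoly N) (RatFun N)).toLinearMap)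

end Operators

/-! ### Permutations acting on rational functions -/

section PermAction

variable {N : ℕ}

/-- The automorphism of `ℂ(x_1, …, x_N)` which permutes the variables by `w`. -/
def permR (w : Equiv.Perm (Fin N)) : RatFun N ≃+* RatFun N :=
  IsFractionRing.ringEquivOfRingEquiv (renameEquiv ℂ w).toRingEquiv

theorem permR_algebraMap (w : Equiv.Perm (Fin N)) (f : XPoly N) :
    permR w (algebraMap (XPoly N) (RatFun N) f) =
      algebraMap (XPoly N) (RatFun N) (rename w f) :=
  IsFractionRing.ringEquivOfRingEquiv_algebraMap _ f

theorem permR_rx (w : Equiv.Perm (Fin N)) (i : Fin N) : permR w (rx i) = rx (w i) := by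
  rw [rx, permR_algebraMap, rename_X, rx]

theorem permR_rc (w : Equiv.Perm (Fin N)) (c : ℂ) : permR w (rc c : RatFun N) = rc c := by
  rw [rc, permR_algebraMap, rename_C]

theorem algebraMap_inj {f g : XPoly N}
    (h : algebraMap (XPoly N) (RatFun N) f = algebraMap (XPoly N) (RatFun N) g) : f = g :=
  IsFractionRing.injective (XPoly N) (RatFun N) h

theorem rx_sub_rx_ne_zero {i j : Fin N} (h : i ≠ j) : (rx i - rx j : RatFun N) ≠ 0 := by
  rw [rx, rx, ← map_sub]
  exact (map_ne_zero_iff _ (IsFractionRing.injective (XPoly N) (RatFun N))).mpr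
    (X_sub_X_ne_zero h)

theorem rc_ne_zero {c : ℂ} (hc : c ≠ 0) : (rc c : RatFun N) ≠ 0 := by
  rw [rc_eq_algebraMap]
  exact (map_ne_zero_iff _ (algebraMap ℂ (RatFun N)).injective).mpr hc

theorem rc_sub_one (c : ℂ) : (rc (c - 1) : RatFun N) = rc c - 1 := by
  rw [rc_eq_algebraMap, rc_eq_algebraMap, map_sub, map_one]

theorem rc_mul_rx_sub_ne_zero {a b : ℂ} (ha : a ≠ 0) {i j : Fin N} (h : i ≠ j) :
    (rc a * rx i - rc b * rx j : RatFun N) ≠ 0 := by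
  simp only [rx, rc]
  rw [← map_mul, ← map_mul, ← map_sub]
  refine (map_ne_zero_iff _ (IsFractionRing.injective (XPoly N) (RatFun N))).mpr fun e => ha ?_
  have := congrArg (eval fun k => if k = i then (1 : ℂ) else 0) e
  simpa [h.symm] using this

/-! ### Products `R_{k,l_1}(t) ⋯ R_{k,l_m}(t)` on functions symmetric in `x_{l_1}, …, x_{l_m}` -/

/-- The identity behind the product formula for the coefficients of the exchanges `σ_{kj}`: here
`a = x_k`, `b = x_j`, and `d` is the variable which is added to the set. -/
theorem exchange_coeff_identity {K : Type*} [Field K] {a b d : K} (hab : a ≠ b) (had : a ≠ d)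
    (hbd : b ≠ d) (c Q : K) :
    (c - 1) * b / (a - b) * ((b - c * d) / (b - d) * Q) =
      (a - c * d) / (a - d) * ((c - 1) * b / (a - b) * Q) +
        (c - 1) * d / (a - d) * ((c - 1) * b / (d - b) * Q) := by
  have h1 := sub_ne_zero.mpr hab
  have h2 := sub_ne_zero.mpr had
  have h3 := sub_ne_zero.mpr hbd
  have h4 := sub_ne_zero.mpr hbd.symm
  field_simp
  ring

theorem sub_one_mul_div_eq {K : Type*} [Field K] {c x y : K} (h : c * y = x) (z : K) :
    (c - 1) * x / (z - x) = c / (x - z) * (y - x) := by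
  rw [← neg_sub x z, div_neg, ← neg_div, div_mul_eq_mul_div, mul_sub, h]
  ring

/-- The coefficient of the exchange `σ_{kj}` in the product of the operators `R_{ki}(t)`, `i ∈ S`,
acting on functions symmetric in the variables indexed by `S`; for `j = k` the exchange is the
identity. -/
def chainCoeff (t : ℂ) (k : Fin N) (S : Finset (Fin N)) (j : Fin N) : RatFun N :=
  if j = k then ∏ i ∈ S, (rx k - rc t * rx i) / (rx k - rx i)
  else (rc (t - 1) * rx j) / (rx k - rx j) *
    ∏ i ∈ S.erase j, (rx j - rc t * rx i) / (rx j - rx i)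

theorem rename_swap_sigma {k m j : Fin N} (hkm : k ≠ m) (hmj : m ≠ j) (f : XPoly N) :
    rename (Equiv.swap k m) (sigma k j f) = sigma k j (sigma m j f) := by
  have h1 : Equiv.swap k m * Equiv.swap k j = Equiv.swap k j * Equiv.swap m j := by
    rw [Equiv.swap_mul_eq_mul_swap, Equiv.swap_inv, Equiv.swap_apply_left,
      Equiv.swap_apply_of_ne_of_ne hkm.symm hmj, Equiv.swap_comm j m]
  rw [sigma, sigma, rename_rename, rename_rename, ← Equiv.Perm.coe_mul, ← Equiv.Perm.coe_mul, h1]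

/-- By induction on the list: applying one more operator `R_{km}(t)` multiplies the coefficient of
`σ_{kj}` by `(x_j - t x_m)/(x_j - x_m)` and creates the exchange `σ_{km}` from the identity. No
other permutation appears, since `σ_{km} σ_{kj} = σ_{kj} σ_{mj}` and `σ_{mj}` fixes the function. -/
theorem algebraMap_chain (t : ℂ) (k : Fin N) (l : List (Fin N)) (hl : l.Nodup) (hk : k ∉ l)
    (f : XPoly N) (hf : ∀ a ∈ l, ∀ b ∈ l, sigma a b f = f) :
    algebraMap (XPoly N) (RatFun N) ((l.map fun j => R t k j).prod f) =
      ∑ j ∈ insert k l.toFinset, chainCoeff t k l.toFinset j *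
        algebraMap (XPoly N) (RatFun N) (sigma k j f) := by
  have hkk : sigma k k f = f := by simp [sigma]
  induction l with
  | nil => simp [chainCoeff, hkk]
  | cons m l ih =>
    rw [List.nodup_cons] at hl
    rw [List.mem_cons, not_or] at hk
    have hkm : k ≠ m := hk.1
    have hm : m ∉ l.toFinset := by simpa using hl.1
    have hkS : k ∉ l.toFinset := by simpa using hk.2
    have ih := ih hl.2 hk.2 fun a ha b hb =>
      hf a (List.mem_cons_of_mem _ ha) b (List.mem_cons_of_mem _ hb)
    rw [List.map_cons, List.prod_cons, Module.End.mul_apply, algebraMap_R t hkm, sigma,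
      ← permR_algebraMap, ih, map_sum, List.toFinset_cons]
    have hσ : ∀ j ∈ l.toFinset, permR (Equiv.swap k m)
        (algebraMap (XPoly N) (RatFun N) (sigma k j f)) =
          algebraMap (XPoly N) (RatFun N) (sigma k j f) := by
      intro j hj
      have hjl : j ∈ l := by simpa using hj
      have hmj : m ≠ j := fun h => hl.1 (h ▸ hjl)
      rw [permR_algebraMap, rename_swap_sigma hkm hmj,
        hf m List.mem_cons_self j (List.mem_cons_of_mem _ hjl)]
    generalize l.toFinset = S at *
    have hkS' : k ∉ insert m S := by simp [hkm, hkS]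
    have hs : permR (Equiv.swap k m) (algebraMap (XPoly N) (RatFun N) f) =
        algebraMap (XPoly N) (RatFun N) (sigma k m f) := permR_algebraMap _ _
    rw [Finset.sum_insert hkS, Finset.sum_insert hkS, Finset.sum_insert hkS',
      Finset.sum_insert hm, hkk, map_mul, hs]
    have e1 : chainCoeff t k (insert m S) k =
        (rx k - rc t * rx m) / (rx k - rx m) * chainCoeff t k S k := by
      simp only [chainCoeff, if_true, Finset.prod_insert hm]
    have hswap : ∀ i ∈ S, Equiv.swap k m i = i := fun i hi =>
      Equiv.swap_apply_of_ne_of_ne (fun h => hkS (h ▸ hi)) (fun h => hm (h ▸ hi))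
    have e2 : chainCoeff t k (insert m S) m =
        (rc (t - 1) * rx m) / (rx k - rx m) * permR (Equiv.swap k m) (chainCoeff t k S k) := by
      simp only [chainCoeff, if_true, if_neg hkm.symm, Finset.erase_insert hm, map_prod]
      congr 1
      refine Finset.prod_congr rfl fun i hi => ?_
      simp only [map_div₀, map_sub, map_mul, permR_rx, permR_rc, Equiv.swap_apply_left, hswap i hi]
    have e3 : ∀ j ∈ S, chainCoeff t k (insert m S) j =
        (rx k - rc t * rx m) / (rx k - rx m) * chainCoeff t k S j +
        (rc (t - 1) * rx m) / (rx k - rx m) *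
          permR (Equiv.swap k m) (chainCoeff t k S j) := by
      intro j hj
      have hjk : j ≠ k := fun h => hkS (h ▸ hj)
      have hjm : j ≠ m := fun h => hm (h ▸ hj)
      have hQ : permR (Equiv.swap k m) (∏ i ∈ S.erase j, (rx j - rc t * rx i) / (rx j - rx i)) =
          ∏ i ∈ S.erase j, (rx j - rc t * rx i) / (rx j - rx i) := by
        rw [map_prod]
        refine Finset.prod_congr rfl fun i hi => ?_
        simp only [map_div₀, map_sub, map_mul, permR_rx, permR_rc, hswap j hj,
          hswap i (Finset.mem_of_mem_erase hi)]
      have hmE : m ∉ S.erase j := fun h => hm (Finset.mem_of_mem_erase h)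
      simp only [chainCoeff, if_neg hjk, Finset.erase_insert_of_ne hjm.symm,
        Finset.prod_insert hmE, map_mul, hQ, map_div₀, map_sub, permR_rx, permR_rc, hswap j hj,
        Equiv.swap_apply_left]
      simp only [rc_sub_one]
      exact exchange_coeff_identity (sub_ne_zero.mp (rx_sub_rx_ne_zero hjk.symm))
        (sub_ne_zero.mp (rx_sub_rx_ne_zero hkm)) (sub_ne_zero.mp (rx_sub_rx_ne_zero hjm)) _ _
    have e4 : ∀ j ∈ S, chainCoeff t k (insert m S) j *
          algebraMap (XPoly N) (RatFun N) (sigma k j f) =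
        (rx k - rc t * rx m) / (rx k - rx m) *
          (chainCoeff t k S j * algebraMap (XPoly N) (RatFun N) (sigma k j f)) +
        (rc (t - 1) * rx m) / (rx k - rx m) * permR (Equiv.swap k m)
          (chainCoeff t k S j * algebraMap (XPoly N) (RatFun N) (sigma k j f)) := by
      intro j hj
      rw [e3 j hj, map_mul, hσ j hj]
      ring
    rw [e1, e2, Finset.sum_congr rfl e4, Finset.sum_add_distrib, ← Finset.mul_sum,
      ← Finset.mul_sum]
    ring

/-! ### Products over pairs of variables -/

/-- The product of `p i j` over all pairs `i < j` in `S`. -/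
def pairProd (S : Finset (Fin N)) (p : Fin N → Fin N → RatFun N) : RatFun N :=
  ∏ i ∈ S, ∏ j ∈ S with i < j, p i j

theorem pairProd_insert {S : Finset (Fin N)} {a : Fin N} (ha : a ∉ S)
    {p : Fin N → Fin N → RatFun N} (hp : ∀ i j, p i j = p j i) :
    pairProd (insert a S) p = (∏ i ∈ S, p a i) * pairProd S p := by
  simp only [pairProd, Finset.prod_filter, Finset.prod_insert ha, lt_irrefl, if_false, one_mul]
  rw [Finset.prod_mul_distrib, ← mul_assoc, ← Finset.prod_mul_distrib]
  congr 1
  refine Finset.prod_congr rfl fun i hi => ?_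
  rcases lt_trichotomy a i with h | rfl | h
  · simp [h, not_lt.mpr h.le]
  · exact absurd hi ha
  · simp [h, not_lt.mpr h.le, hp i a]

/-- The product over pairs does not depend on the order of the index set. -/
theorem pairProd_map (w : Equiv.Perm (Fin N)) (S : Finset (Fin N))
    {p : Fin N → Fin N → RatFun N} (hp : ∀ i j, p i j = p j i) :
    pairProd (S.map w.toEmbedding) p = pairProd S fun i j => p (w i) (w j) := by
  induction S using Finset.induction_on with
  | empty => simp [pairProd]
  | insert a S ha ih =>
    rw [Finset.map_insert, pairProd_insert (by simpa using ha) hp, ih,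
      pairProd_insert ha fun i j => hp _ _, Finset.prod_map]
    rfl

/-- The factor `(t^{n_j} x_i - t^{n_i} x_j)/(x_i - x_j)`, which is symmetric in `i` and `j`. -/
def pairFactor (t : ℂ) (n : Fin N → ℤ) (i j : Fin N) : RatFun N :=
  (rc (t ^ n j) * rx i - rc (t ^ n i) * rx j) / (rx i - rx j)

theorem pairFactor_symm (t : ℂ) (n : Fin N → ℤ) (i j : Fin N) :
    pairFactor t n i j = pairFactor t n j i := by
  rw [pairFactor, pairFactor, ← neg_div_neg_eq, neg_sub, neg_sub]

theorem dellCoeff_eq_pairProd (t : ℂ) (n : Fin N → ℤ) :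
    dellCoeff t n = pairProd Finset.univ (pairFactor t n) := by
  simp only [dellCoeff, pairProd, pairFactor, Finset.filter_lt_eq_Ioi]

/-- The part of the summand of `D_N` which involves only the variables indexed by `S`, normalised
by the factor `∏ t^{e n_i}`. -/
def partialCoeff (t : ℂ) (e : ℕ) (S : Finset (Fin N)) (n : Fin N → ℤ) : RatFun N :=
  (∏ i ∈ S, rc (t ^ n i) ^ e) * pairProd S (pairFactor t n)

/-- The summands of `D_N` are equivariant: permuting the variables amounts to permuting the
exponents and the index set. -/
theorem permR_partialCoeff (w : Equiv.Perm (Fin N)) (t : ℂ) (e : ℕ) (S : Finset (Fin N))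
    (n : Fin N → ℤ) :
    permR w (partialCoeff t e S (n ∘ w)) = partialCoeff t e (S.map w.toEmbedding) n := by
  rw [partialCoeff, partialCoeff, pairProd_map w S (pairFactor_symm t n), Finset.prod_map, map_mul]
  simp only [pairProd, map_prod, map_pow, permR_rc, pairFactor, map_div₀, map_sub, map_mul,
    permR_rx, Function.comp_apply]
  rfl

/-- The recursion for the coefficients of `D_N`, by Lagrange interpolation of the monic
polynomial `∏_{i ∈ S} (z - x_i)` at the nodes `x_j / t^{n_j}`, `j ∈ S ∪ {k}`. -/
theorem sum_chainCoeff_mul_partialCoeff {t : ℂ} (ht : t ≠ 0) (n : Fin N → ℤ) {k : Fin N}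
    {S : Finset (Fin N)} (hk : k ∉ S) (e : ℕ) :
    ∑ j ∈ insert k S, rc (t ^ n j) ^ e * chainCoeff (t ^ n j) k S j *
        partialCoeff t (e + 1) ((insert k S).erase j) n =
      partialCoeff t e (insert k S) n := by
  have hc : ∀ j, (rc (t ^ n j) : RatFun N) ≠ 0 := fun j => rc_ne_zero (zpow_ne_zero _ ht)
  let y : Fin N → RatFun N := fun j => rx j / rc (t ^ n j)
  have hy : ∀ j, rx j = rc (t ^ n j) * y j := fun j => by
    simp only [y]
    field_simp [hc j]
  have hnum : ∀ i j, i ≠ j → rc (t ^ n j) * rx i - rc (t ^ n i) * rx j ≠ 0 := fun i j h =>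
    rc_mul_rx_sub_ne_zero (zpow_ne_zero _ ht) h
  have hyy : ∀ i j, i ≠ j → y i - y j ≠ 0 := by
    intro i j h e
    apply hnum i j h
    rw [hy i, hy j, sub_eq_zero.mp e]
    ring
  let P : Polynomial (RatFun N) := ∏ i ∈ S, (Polynomial.X - Polynomial.C (rx i))
  have hP : P.Monic := Polynomial.monic_prod_of_monic _ _ fun i _ => Polynomial.monic_X_sub_C _
  have hdeg : ((insert k S).card : WithBot ℕ) = P.degree + 1 := by
    rw [Polynomial.degree_eq_natDegree hP.ne_zero,
      Polynomial.natDegree_prod_of_monic _ _ fun i _ => Polynomial.monic_X_sub_C _,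
      Finset.card_insert_of_notMem hk]
    simp
  have hL := Lagrange.leadingCoeff_eq_sum (s := insert k S) (v := y)
    (fun i _ j _ h => by
      by_contra hij
      exact hyy i j hij (sub_eq_zero.mpr h)) hdeg
  rw [hP.leadingCoeff] at hL
  rw [← mul_one (partialCoeff t e (insert k S) n), hL, Finset.mul_sum]
  refine Finset.sum_congr rfl fun j hj => ?_
  have heval : P.eval (y j) = ∏ i ∈ S, (y j - rx i) := by
    simp [P, Polynomial.eval_prod]
  -- splitting off the index `j` from the pairs of `S ∪ {k}`
  have hsplit : partialCoeff t e (insert k S) n =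
      rc (t ^ n j) ^ e * (∏ i ∈ (insert k S).erase j, rc (t ^ n i) ^ e) *
        ((∏ i ∈ (insert k S).erase j, pairFactor t n j i) *
          pairProd ((insert k S).erase j) (pairFactor t n)) := by
    rw [partialCoeff, ← pairProd_insert (Finset.notMem_erase j _) (pairFactor_symm t n),
      Finset.insert_erase hj, Finset.mul_prod_erase _ (fun i => rc (t ^ n i) ^ e) hj]
  have hpf : ∀ i ∈ (insert k S).erase j, pairFactor t n j i =
      rc (t ^ n i) * (rc (t ^ n j) * (y j - y i) / (rx j - rx i)) := by
    intro i hi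
    rw [pairFactor]
    nth_rw 1 [hy i, hy j]
    ring
  have key : chainCoeff (t ^ n j) k S j =
      (∏ i ∈ (insert k S).erase j, rc (t ^ n j) * (y j - y i) / (rx j - rx i)) *
        ((∏ i ∈ S, (y j - rx i)) / ∏ i ∈ (insert k S).erase j, (y j - y i)) := by
    have hne : ∏ i ∈ (insert k S).erase j, (y j - y i) ≠ 0 :=
      Finset.prod_ne_zero_iff.mpr fun i hi => hyy j i (Finset.ne_of_mem_erase hi).symm
    have hcy : rc (t ^ n j) * y j = rx j := (hy j).symm
    have hterm : ∀ i, (rx j - rc (t ^ n j) * rx i) / (rx j - rx i) =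
        rc (t ^ n j) / (rx j - rx i) * (y j - rx i) := fun i => by
      rw [← hcy]
      ring
    have hE : (∏ i ∈ (insert k S).erase j, rc (t ^ n j) * (y j - y i) / (rx j - rx i)) =
        (∏ i ∈ (insert k S).erase j, rc (t ^ n j) / (rx j - rx i)) *
          ∏ i ∈ (insert k S).erase j, (y j - y i) := by
      rw [← Finset.prod_mul_distrib]
      exact Finset.prod_congr rfl fun i _ => by ring
    rw [hE, mul_assoc, mul_div_cancel₀ _ hne]
    rcases eq_or_ne j k with rfl | hjk
    · rw [chainCoeff, if_pos rfl, Finset.erase_insert hk, ← Finset.prod_mul_distrib]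
      exact Finset.prod_congr rfl fun i _ => hterm i
    · have hjS : j ∈ S := Finset.mem_of_mem_insert_of_ne hj hjk
      have hkE : k ∉ S.erase j := fun h => hk (Finset.mem_of_mem_erase h)
      rw [chainCoeff, if_neg hjk, Finset.erase_insert_of_ne hjk.symm, Finset.prod_insert hkE,
        ← Finset.mul_prod_erase S (fun i => y j - rx i) hjS,
        Finset.prod_congr rfl fun i _ => hterm i, Finset.prod_mul_distrib]
      have h0 : (rc (t ^ n j - 1) * rx j) / (rx k - rx j) =
          rc (t ^ n j) / (rx j - rx k) * (y j - rx j) := by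
        rw [rc_sub_one]
        exact sub_one_mul_div_eq hcy _
      rw [h0]
      ring
  rw [hsplit, heval, Finset.prod_congr rfl hpf, Finset.prod_mul_distrib, key, partialCoeff]
  simp only [pow_succ]
  rw [Finset.prod_mul_distrib]
  generalize (∏ i ∈ (insert k S).erase j, rc (t ^ n j) * (y j - y i) / (rx j - rx i)) = A
  generalize ((∏ i ∈ S, (y j - rx i)) / ∏ i ∈ (insert k S).erase j, (y j - y i)) = B
  ring

end PermAction

/-! ### The product of Cherednik operators on symmetric polynomials -/

section CherednikProduct

variable {N : ℕ}

/-- The product `R_{i,i+1}(t) ⋯ R_{iN}(t)`. -/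
def chain (t : ℂ) (i : Fin N) : Module.End ℂ (XPoly N) :=
  (((List.finRange N).filter (fun j => i < j)).map (fun j => R t i j)).prod

theorem list_prod_apply_comm {V : Type*} [AddCommGroup V] [Module ℂ V] (l : List (Module.End ℂ V))
    (φ : Module.End ℂ V) (h : ∀ T ∈ l, ∀ f, φ (T f) = T (φ f)) (f : V) :
    φ (l.prod f) = l.prod (φ f) := by
  have : Commute φ l.prod := Commute.list_prod_right l φ fun T hT => LinearMap.ext (h T hT)
  exact LinearMap.congr_fun this.eq f

theorem sigma_chain (t : ℂ) {a b i : Fin N} (ha : a < i) (hb : b < i) (f : XPoly N) :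
    sigma a b (chain t i f) = chain t i (sigma a b f) := by
  refine list_prod_apply_comm _ (sigma a b).toLinearMap (fun T hT f => ?_) f
  obtain ⟨j, hj, rfl⟩ := List.mem_map.mp hT
  have hij : i < j := by simpa using hj
  exact sigma_R_of_ne t ha.ne (ha.trans hij).ne hb.ne (hb.trans hij).ne f

theorem gam_chain (q t : ℂ) {k i : Fin N} (hk : k < i) (f : XPoly N) :
    gam q k (chain t i f) = chain t i (gam q k f) := by
  refine list_prod_apply_comm _ (gam q k) (fun T hT f => ?_) f
  obtain ⟨j, hj, rfl⟩ := List.mem_map.mp hT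
  have hij : i < j := by simpa using hj
  exact gam_R_of_ne q t hk.ne' (hk.trans hij).ne' f

/-- On polynomials symmetric in `x_1, …, x_i`, the inverses in the definition of `C_i` act as the
identity. -/
theorem cherednik_apply_of_symm {t : ℂ} (ht : t ≠ 0) (q : ℂ) (i : Fin N) {f : XPoly N}
    (hf : ∀ a ≤ i, ∀ b ≤ i, sigma a b f = f) :
    cherednik i q t f = t ^ (i : ℕ) • chain t i (gam q i f) := by
  have h : ∀ l : List (Fin N), (∀ j ∈ l, j < i) →
      (l.map fun j => Ring.inverse (R t j i)).prod f = f := by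
    intro l
    induction l with
    | nil => simp
    | cons j l ih =>
      intro hl
      rw [List.map_cons, List.prod_cons, Module.End.mul_apply,
        ih fun j hj => hl j (List.mem_cons_of_mem _ hj), inverse_R ht,
        R_of_sigma_eq _ (hf j (hl j List.mem_cons_self).le i le_rfl)]
  rw [cherednik, LinearMap.smul_apply, Module.End.mul_apply, Module.End.mul_apply,
    h _ fun j hj => by simpa using hj]
  rfl

theorem ofFn_drop_prod {M : Type*} [Monoid M] (g : Fin N → M) (k : Fin N) :
    ((List.ofFn g).drop k).prod = g k * ((List.ofFn g).drop (k + 1)).prod := by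
  rw [List.drop_eq_getElem_cons (by simp), List.prod_cons]
  simp

theorem exists_of_mem_ofFn_drop {M : Type*} {g : Fin N → M} {k : ℕ} {x : M}
    (h : x ∈ (List.ofFn g).drop k) : ∃ i : Fin N, k ≤ i ∧ g i = x := by
  obtain ⟨i, hi, rfl⟩ := List.mem_drop_iff_getElem.mp h
  exact ⟨⟨k + i, by simpa [add_comm] using hi⟩, by simp, by simp⟩

/-- In the product `C_k ⋯ C_N` (with independent parameters) on symmetric polynomials, the
inverses disappear and all the scalings `γ_i` can be moved to the right. This rests on the fact,
proved along with it, that the result of `C_k ⋯ C_N` is still symmetric in the variables before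
`x_k`. -/
theorem cherednik_prod_drop {q t : Fin N → ℂ} (ht : ∀ i, t i ≠ 0) {f : XPoly N}
    (hf : f.IsSymmetric) (k : ℕ) (hk : k ≤ N) :
    ((List.ofFn fun i => cherednik i (q i) (t i)).drop k).prod f =
        ((List.ofFn fun i => t i ^ (i : ℕ) • chain (t i) i).drop k).prod
          (((List.ofFn fun i => gam (q i) i).drop k).prod f) ∧
      ∀ a b : Fin N, (a : ℕ) < k → (b : ℕ) < k →
        sigma a b (((List.ofFn fun i => cherednik i (q i) (t i)).drop k).prod f) =
          ((List.ofFn fun i => cherednik i (q i) (t i)).drop k).prod f := by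
  induction hk using Nat.decreasingInduction with
  | self =>
    rw [List.drop_of_length_le (by simp), List.drop_of_length_le (by simp),
      List.drop_of_length_le (by simp)]
    exact ⟨rfl, fun a b _ _ => hf _⟩
  | of_succ k hk ih =>
    obtain ⟨ih1, ih2⟩ := ih
    have hstep := ofFn_drop_prod (fun i => cherednik i (q i) (t i)) ⟨k, hk⟩
    have hstep2 := ofFn_drop_prod (fun i => gam (q i) i) ⟨k, hk⟩
    have hstep3 := ofFn_drop_prod (fun i => t i ^ (i : ℕ) • chain (t i) i) ⟨k, hk⟩
    dsimp only at hstep hstep2 hstep3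
    rw [hstep, hstep2, hstep3]
    simp only [Module.End.mul_apply]
    rw [cherednik_apply_of_symm (ht _) _ _ fun a ha b hb =>
      ih2 a b (Nat.lt_succ_of_le ha) (Nat.lt_succ_of_le hb)]
    refine ⟨?_, fun a b ha hb => ?_⟩
    · rw [ih1, LinearMap.smul_apply, list_prod_apply_comm _ (gam (q ⟨k, hk⟩) ⟨k, hk⟩)]
      intro T hT g
      obtain ⟨i, hi, rfl⟩ := exists_of_mem_ofFn_drop hT
      rw [LinearMap.smul_apply, LinearMap.smul_apply, map_smul, gam_chain _ _ hi]
    · rw [map_smul, sigma_chain _ ha hb, sigma_gam_of_ne _ (Fin.ne_of_lt ha) (Fin.ne_of_lt hb),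
        ih2 a b (ha.trans k.lt_succ_self) (hb.trans k.lt_succ_self)]

end CherednikProduct

/-! ### Symmetrisation over the exponents -/

section Symmetrisation

variable {N : ℕ}

/-- The permutations which fix the indices less than `k`. -/
def fixingBelow (N k : ℕ) : Subgroup (Equiv.Perm (Fin N)) where
  carrier := {w | ∀ i : Fin N, (i : ℕ) < k → w i = i}
  mul_mem' {v w} hv hw i hi := by rw [Equiv.Perm.mul_apply, hw i hi, hv i hi]
  one_mem' _ _ := rfl
  inv_mem' {w} hw i hi := by rw [Equiv.Perm.inv_eq_iff_eq, hw i hi]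

instance (k : ℕ) : DecidablePred (· ∈ fixingBelow N k) := fun _ =>
  inferInstanceAs (Decidable (∀ i : Fin N, (i : ℕ) < k → _ = i))

theorem fixingBelow_mono {k l : ℕ} (h : k ≤ l) : fixingBelow N l ≤ fixingBelow N k :=
  fun _ hw i hi => hw i (hi.trans_le h)

theorem map_ge_of_mem_fixingBelow {k : ℕ} {w : Equiv.Perm (Fin N)} (hw : w ∈ fixingBelow N k) :
    (Finset.univ.filter fun i : Fin N => k ≤ i).map w.toEmbedding =
      Finset.univ.filter fun i : Fin N => k ≤ i := by
  have hle (v : Equiv.Perm (Fin N)) (hv : v ∈ fixingBelow N k) (i : Fin N) (hi : k ≤ i) :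
      k ≤ v i := by
    by_contra hlt
    have := hv (v i) (not_le.mp hlt)
    rw [v.injective this] at hlt
    exact hlt hi
  ext i
  simp only [Finset.mem_map, Finset.mem_filter, Finset.mem_univ, true_and, Equiv.coe_toEmbedding]
  constructor
  · rintro ⟨j, hj, rfl⟩
    exact hle w hw j hj
  · intro hi
    exact ⟨w⁻¹ i, hle _ (inv_mem hw) i hi, by simp⟩

/-- The sum over the group of permutations of the exponents which fix the indices less than `k`. -/
def symmSum {W : Type*} [AddCommMonoid W] (k : ℕ) (F : (Fin N → ℤ) → W) (n : Fin N → ℤ) : W :=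
  ∑ w : fixingBelow N k, F (n ∘ (w : Equiv.Perm (Fin N)))

theorem symmSum_comp_right {W : Type*} [AddCommMonoid W] {k : ℕ} (F : (Fin N → ℤ) → W)
    (n : Fin N → ℤ) {v : Equiv.Perm (Fin N)} (hv : v ∈ fixingBelow N k) :
    symmSum k (fun m => F (m ∘ v)) n = symmSum k F n :=
  Fintype.sum_equiv (Equiv.mulRight (⟨v, hv⟩ : fixingBelow N k)) _ _ fun _ => rfl

/-- Summing over a subgroup first does not change the symmetrisation, up to the order of the
subgroup. -/
theorem symmSum_symmSum {W : Type*} [AddCommMonoid W] {k l : ℕ} (h : k ≤ l)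
    (F : (Fin N → ℤ) → W) (n : Fin N → ℤ) :
    symmSum k (symmSum l F) n = Fintype.card (fixingBelow N l) • symmSum k F n := by
  have : symmSum k (symmSum l F) n = ∑ v : fixingBelow N l,
      symmSum k (fun m => F (m ∘ (v : Equiv.Perm (Fin N)))) n := by
    simp only [symmSum]
    exact Finset.sum_comm
  rw [this, Finset.sum_congr rfl fun v _ =>
    symmSum_comp_right F n (fixingBelow_mono h v.2), Finset.sum_const, Finset.card_univ]

/-- The symmetrisations of the families `n ↦ R_k(t^{n_k}) ⋯ R_N(t^{n_N}) h_n` (with powers of `t`)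
and `n ↦ (coefficient of D) h_n` agree. Here `h` is a family of polynomials such that permuting the
variables amounts to permuting the exponents.

The proof is by descending induction on `k`. Once symmetrised over the exponents after `k`, the
family is symmetric in the variables after `x_k`, so `algebraMap_chain` expands the action of `R_k`;
summing over the exponents from `k` on turns each exchange `σ_{kj}` of variables into one of
exponents, and the coefficients add up by `sum_chainCoeff_mul_partialCoeff`. -/
theorem symmSum_chain_eq {t : ℂ} (ht : t ≠ 0) {h : (Fin N → ℤ) → XPoly N}
    (hh : ∀ (w : Equiv.Perm (Fin N)) (n : Fin N → ℤ), rename w (h (n ∘ w)) = h n)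
    (k : ℕ) (hk : k ≤ N) (n : Fin N → ℤ) :
    algebraMap (XPoly N) (RatFun N) (symmSum k (fun n =>
        ((List.ofFn fun i => (t ^ n i) ^ (i : ℕ) • chain (t ^ n i) i).drop k).prod (h n)) n) =
      symmSum k (fun n => partialCoeff t k (Finset.univ.filter fun i : Fin N => k ≤ i) n *
        algebraMap (XPoly N) (RatFun N) (h n)) n := by
  have hG (w : Equiv.Perm (Fin N)) (e : ℕ) (S : Finset (Fin N)) (n : Fin N → ℤ) :
      permR w (partialCoeff t e S (n ∘ w) * algebraMap (XPoly N) (RatFun N) (h (n ∘ w))) =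
        partialCoeff t e (S.map w.toEmbedding) n * algebraMap (XPoly N) (RatFun N) (h n) := by
    rw [map_mul, permR_partialCoeff, permR_algebraMap, hh]
  induction hk using Nat.decreasingInduction generalizing n with
  | self =>
    have h0 : (Finset.univ.filter fun i : Fin N => N ≤ i) = ∅ := by
      ext i
      simp
    have (n : Fin N → ℤ) :
        (List.ofFn fun i => (t ^ n i) ^ (i : ℕ) • chain (t ^ n i) i).drop N = [] :=
      List.drop_of_length_le (by simp)
    simp only [h0, this, symmSum, map_sum]
    simp [partialCoeff, pairProd]
  | of_succ k hk ih =>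
    obtain ⟨κ, hκ⟩ : ∃ κ : Fin N, (κ : ℕ) = k := ⟨⟨k, hk⟩, rfl⟩
    subst hκ
    set F : ℕ → (Fin N → ℤ) → XPoly N := fun k n =>
      ((List.ofFn fun i => (t ^ n i) ^ (i : ℕ) • chain (t ^ n i) i).drop k).prod (h n) with hF
    set S : Finset (Fin N) := Finset.univ.filter fun i : Fin N => (κ : ℕ) + 1 ≤ i with hS
    set G : (Fin N → ℤ) → RatFun N := fun n =>
      partialCoeff t (κ + 1) S n * algebraMap (XPoly N) (RatFun N) (h n) with hGdef
    have hκS : κ ∉ S := by simp [hS]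
    have hins : (Finset.univ.filter fun i : Fin N => (κ : ℕ) ≤ i) = insert κ S := by
      ext i
      simp only [hS, Finset.mem_filter, Finset.mem_univ, true_and, Finset.mem_insert, Fin.ext_iff]
      omega
    have hFstep (n : Fin N → ℤ) : F κ n =
        (t ^ n κ) ^ (κ : ℕ) • chain (t ^ n κ) κ (F (κ + 1) n) := by
      simp only [hF]
      rw [ofFn_drop_prod]
      rfl
    -- `M n` is symmetric in the variables with index greater than `κ`
    set M : (Fin N → ℤ) → XPoly N := symmSum (κ + 1) (F (κ + 1)) with hM
    have hMsymm (v : Equiv.Perm (Fin N)) (hv : v ∈ fixingBelow N (κ + 1)) (n : Fin N → ℤ) :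
        rename v (M n) = M n := by
      apply algebraMap_inj
      rw [← permR_algebraMap, ih]
      refine Eq.trans ?_ (symmSum_comp_right G n (inv_mem hv))
      rw [symmSum, map_sum]
      refine Finset.sum_congr rfl fun w _ => ?_
      have := hG v (κ + 1) S ((n ∘ (w : Equiv.Perm (Fin N))) ∘ (v⁻¹ : Equiv.Perm (Fin N)))
      rw [map_ge_of_mem_fixingBelow hv] at this
      refine Eq.trans ?_ this
      simp only [hGdef, Function.comp_assoc, ← Equiv.Perm.coe_mul, inv_mul_cancel_right]
    -- the summand of index `j` of `R_κ M`
    let H : Fin N → (Fin N → ℤ) → RatFun N := fun j n =>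
      rc (t ^ n κ) ^ (κ : ℕ) * (chainCoeff (t ^ n κ) κ S j * permR (Equiv.swap κ j) (G n))
    have h1 (n : Fin N → ℤ) : algebraMap (XPoly N) (RatFun N) (symmSum (κ + 1) (F κ) n) =
        symmSum (κ + 1) (fun n => ∑ j ∈ insert κ S, H j n) n := by
      have hκv (v : fixingBelow N (κ + 1)) : (v : Equiv.Perm (Fin N)) κ = κ :=
        v.2 κ (Nat.lt_succ_self _)
      have e1 : symmSum (κ + 1) (F κ) n = (t ^ n κ) ^ (κ : ℕ) • chain (t ^ n κ) κ (M n) := by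
        simp only [hM, symmSum, map_sum, Finset.smul_sum, hFstep, Function.comp_apply, hκv]
      have hl : ((List.finRange N).filter (fun j => κ < j)).toFinset = S := by
        ext i
        simp only [hS, List.mem_toFinset, List.mem_filter, List.mem_finRange, true_and,
          decide_eq_true_eq, Finset.mem_filter, Finset.mem_univ, Nat.succ_le_iff, Fin.lt_def]
      have e2 := algebraMap_chain (t ^ n κ) κ ((List.finRange N).filter (fun j => κ < j))
        ((List.nodup_finRange N).filter _) (by simp) (M n) (fun a ha b hb =>
          hMsymm _ (fun i hi => by
            have ha' : κ < a := by simpa using ha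
            have hb' : κ < b := by simpa using hb
            have hi' : i ≤ κ := Nat.lt_succ_iff.mp hi
            exact Equiv.swap_apply_of_ne_of_ne (hi'.trans_lt ha').ne (hi'.trans_lt hb').ne) n)
      rw [hl] at e2
      have e3 (j : Fin N) : algebraMap (XPoly N) (RatFun N) (sigma κ j (M n)) =
          ∑ v : fixingBelow N (κ + 1),
            permR (Equiv.swap κ j) (G (n ∘ (v : Equiv.Perm (Fin N)))) := by
        rw [sigma, ← permR_algebraMap, ih, symmSum, map_sum]
      rw [e1, smul_eq_C_mul, map_mul, C_pow, map_pow, chain, e2]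
      simp only [e3, symmSum, H, Function.comp_apply, hκv, Finset.mul_sum]
      exact Finset.sum_comm
    have h2 (j : Fin N) (hj : j ∈ insert κ S) (n : Fin N → ℤ) : H j (n ∘ Equiv.swap κ j) =
        rc (t ^ n j) ^ (κ : ℕ) * chainCoeff (t ^ n j) κ S j *
          partialCoeff t (κ + 1) ((insert κ S).erase j) n *
            algebraMap (XPoly N) (RatFun N) (h n) := by
      have hSj : S.map (Equiv.swap κ j).toEmbedding = (insert κ S).erase j := by
        ext i
        rw [Finset.mem_map_equiv, Equiv.symm_swap, Finset.mem_erase]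
        rcases eq_or_ne i κ with rfl | hik
        · rw [Equiv.swap_apply_left]
          rcases eq_or_ne i j with rfl | hij
          · simp [hκS]
          · simpa [hij, hij.symm] using hj
        · rcases eq_or_ne i j with rfl | hij
          · simp [hκS]
          · simp [Equiv.swap_apply_of_ne_of_ne hik hij, hik, hij]
      simp only [H, hGdef]
      rw [hG, hSj, Function.comp_apply, Equiv.swap_apply_left]
      ring
    have hswap (j : Fin N) (hj : j ∈ insert κ S) : Equiv.swap κ j ∈ fixingBelow N κ := by
      intro i hi
      rw [← hins, Finset.mem_filter] at hj
      exact Equiv.swap_apply_of_ne_of_ne (Fin.ne_of_lt hi) (Fin.ne_of_lt (hi.trans_le hj.2))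
    have h3 : symmSum κ (fun n => ∑ j ∈ insert κ S, H j n) n =
        symmSum κ (fun n => partialCoeff t κ (insert κ S) n *
          algebraMap (XPoly N) (RatFun N) (h n)) n := by
      have e1 : symmSum κ (fun n => ∑ j ∈ insert κ S, H j n) n =
          ∑ j ∈ insert κ S, symmSum κ (fun n => H j (n ∘ Equiv.swap κ j)) n := by
        rw [Finset.sum_congr rfl fun j hj => symmSum_comp_right (H j) n (hswap j hj)]
        exact Finset.sum_comm
      rw [e1]
      simp only [symmSum]
      rw [Finset.sum_comm]
      refine Finset.sum_congr rfl fun w _ => ?_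
      rw [Finset.sum_congr rfl fun j hj => h2 j hj _, ← Finset.sum_mul,
        sum_chainCoeff_mul_partialCoeff ht _ hκS]
    have h4 : algebraMap (XPoly N) (RatFun N) (symmSum κ (symmSum (κ + 1) (F κ)) n) =
        symmSum κ (symmSum (κ + 1) fun n => ∑ j ∈ insert κ S, H j n) n := by
      rw [symmSum, map_sum]
      exact Finset.sum_congr rfl fun w _ => h1 _
    rw [symmSum_symmSum (Nat.le_succ _), symmSum_symmSum (Nat.le_succ _), map_nsmul, h3] at h4
    rw [hins]
    exact (smul_right_inj Fintype.card_ne_zero).mp h4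

/-- The product of the Cherednik operators with parameters `(q^{n_i}, t^{n_i})` and the summand of
`D_N` of index `n` agree on symmetric polynomials after symmetrisation in `n`. -/
theorem sum_perm_cherednik_eq {q t : ℂ} (ht : t ≠ 0) {f : XPoly N} (hf : f.IsSymmetric)
    (n : Fin N → ℤ) :
    ∑ w : Equiv.Perm (Fin N), algebraMap (XPoly N) (RatFun N)
        ((List.ofFn fun i => cherednik i (q ^ (n ∘ w) i) (t ^ (n ∘ w) i)).prod f) =
      ∑ w : Equiv.Perm (Fin N), dellCoeff t (n ∘ w) * algebraMap (XPoly N) (RatFun N)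
        ((List.ofFn fun i => gam (q ^ (n ∘ w) i) i).prod f) := by
  have key := symmSum_chain_eq ht (h := fun n => (List.ofFn fun i => gam (q ^ n i) i).prod f)
    (fun w n => rename_ofFn_gam_prod q n w f hf) 0 (Nat.zero_le N) n
  have e {W : Type} [AddCommMonoid W] (F : (Fin N → ℤ) → W) :
      symmSum 0 F n = ∑ w : Equiv.Perm (Fin N), F (n ∘ w) :=
    Fintype.sum_equiv (Equiv.subtypeUnivEquiv fun w i hi => absurd hi (Nat.not_lt_zero _)) _ _
      fun _ => rfl
  rw [e, e, map_sum] at key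
  have hc (n : Fin N → ℤ) := (cherednik_prod_drop (q := fun i => q ^ n i) (t := fun i => t ^ n i)
    (fun i => zpow_ne_zero _ ht) hf 0 (Nat.zero_le N)).1
  simp only [List.drop_zero] at hc key
  rw [Finset.sum_congr rfl fun w _ => by rw [hc]]
  refine key.trans (Finset.sum_congr rfl fun w _ => ?_)
  rw [dellCoeff_eq_pairProd, partialCoeff]
  simp

end Symmetrisation

/-! ### Comparison of the two series -/

section Comparison

variable {N : ℕ} {ω q t u : ℂ}

theorem opSummable_PthetaTerm_cherednik (hω0 : ω ≠ 0) (hω1 : ‖ω‖ < 1) (hq : q ≠ 0) (ht : t ≠ 0)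
    (hu : u ≠ 0) (i : Fin N) : OpSummable (PthetaTerm ω u (cherednik i) q t) :=
  (rapidlyDecreasing_thetaWeight hω0 hω1 hu).opSummable (cherednik_mem_expFam hq ht i)

theorem opSummable_dellTerm (hω0 : ω ≠ 0) (hω1 : ‖ω‖ < 1) (hq : q ≠ 0) (ht : t ≠ 0)
    (hu : u ≠ 0) : OpSummable (dellTerm N ω u q t) := by
  refine opSummable_of_forall fun f => ?_
  simp only [dellTerm_eq hω0 hu]
  exact ((rapidlyDecreasing_thetaWeight hω0 hω1 hu).pi N).exists_hasSum
    (dellTerm_mem_expFam hq ht f)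

/-- Two weak sums of families over `ℤ^N` with the same symmetrisation over `S_N` are equal. -/
theorem eq_of_sum_perm_eq {W : Type*} [AddCommGroup W] [Module ℂ W] {F G : (Fin N → ℤ) → W}
    {s s' : W} (hF : ∀ φ : W →ₗ[ℂ] ℂ, HasSum (fun n => φ (F n)) (φ s))
    (hG : ∀ φ : W →ₗ[ℂ] ℂ, HasSum (fun n => φ (G n)) (φ s'))
    (h : ∀ n, ∑ w : Equiv.Perm (Fin N), F (n ∘ w) = ∑ w : Equiv.Perm (Fin N), G (n ∘ w)) :
    s = s' := by
  have aux {F : (Fin N → ℤ) → W} {s : W}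
      (hF : ∀ φ : W →ₗ[ℂ] ℂ, HasSum (fun n => φ (F n)) (φ s)) (φ : W →ₗ[ℂ] ℂ) :
      HasSum (fun n => φ (∑ w : Equiv.Perm (Fin N), F (n ∘ w)))
        (φ (Fintype.card (Equiv.Perm (Fin N)) • s)) := by
    have := hasSum_sum fun (w : Equiv.Perm (Fin N)) (_ : w ∈ Finset.univ) =>
      ((w.symm.arrowCongr (Equiv.refl ℤ)).hasSum_iff.mpr (hF φ))
    rw [Finset.sum_const, Finset.card_univ] at this
    simp only [map_sum, map_nsmul]
    exact this
  have h1 := eq_of_forall_hasSum (aux hF) (by simpa only [h] using aux hG)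
  rw [← Nat.cast_smul_eq_nsmul ℂ, ← Nat.cast_smul_eq_nsmul ℂ] at h1
  exact smul_right_injective W (Nat.cast_ne_zero.mpr Fintype.card_ne_zero) h1

theorem dell_eq_prod_Ptheta (hω0 : ω ≠ 0) (hω1 : ‖ω‖ < 1) (hq : q ≠ 0) (ht : t ≠ 0)
    (hu : u ≠ 0) {f : XPoly N} (hf : f.IsSymmetric) :
    dell N ω u q t f = algebraMap (XPoly N) (RatFun N)
      ((List.ofFn fun i : Fin N => Ptheta ω u (cherednik i) q t).prod f) := by
  have hprod := hasOpSum_list_prod (rapidlyDecreasing_thetaWeight hω0 hω1 hu)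
    (fun (i : Fin N) n => cherednik i (q ^ n) (t ^ n)) (cherednik_mem_expFam hq ht)
    (fun i => Ptheta ω u (cherednik i) q t)
    (fun i => (opSummable_PthetaTerm_cherednik hω0 hω1 hq ht hu i).hasOpSum)
  refine eq_of_sum_perm_eq
    (fun φ => (opSummable_dellTerm hω0 hω1 hq ht hu).hasOpSum f φ)
    (fun φ => hprod f (φ ∘ₗ (IsScalarTower.toAlgHom ℂ (XPoly N) (RatFun N)).toLinearMap))
    fun n => ?_
  have hw (w : Equiv.Perm (Fin N)) :
      ∏ i, thetaWeight ω u ((n ∘ w) i) = ∏ i, thetaWeight ω u (n i) :=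
    Equiv.prod_comp w fun i => thetaWeight ω u (n i)
  simp only [dellTerm_eq hω0 hu, LinearMap.smul_apply, map_smul, hw, ← Finset.smul_sum]
  exact congrArg _ (sum_perm_cherednik_eq ht hf n).symm

end Comparison

/-! ### The theta function -/

section Theta

variable {ω : ℂ}

/-- The theta function `θ_ω(z) = ∑ ω^((n²-n)/2) (-z)^n`. -/
def theta (ω z : ℂ) : ℂ := ∑' n : ℤ, thetaWeight ω z n

theorem summable_thetaWeight (h0 : ω ≠ 0) (h1 : ‖ω‖ < 1) {z : ℂ} (hz : z ≠ 0) :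
    Summable (thetaWeight ω z) :=
  summable_theta h0 h1 (neg_ne_zero.mpr hz)

/-- The quasi-periodicity of `θ_ω`, by the shift `n ↦ n + 1` of the summation index. -/
theorem theta_mul_left (h0 : ω ≠ 0) {z : ℂ} (hz : z ≠ 0) :
    theta ω (ω * z) = -(theta ω z / z) := by
  rw [theta, theta, ← (Equiv.addRight (1 : ℤ)).tsum_eq (thetaWeight ω z), ← div_neg,
    ← tsum_div_const]
  refine tsum_congr fun n => ?_
  have h2 : ((n + 1) ^ 2 - (n + 1)) / 2 = (n ^ 2 - n) / 2 + n := by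
    have := two_mul_half_sq_sub n
    have := two_mul_half_sq_sub (n + 1)
    linarith
  have hz' : -z ≠ 0 := neg_ne_zero.mpr hz
  rw [Equiv.coe_addRight, thetaWeight, thetaWeight, h2, zpow_add₀ h0, zpow_add_one₀ hz',
    ← mul_neg, mul_zpow]
  field_simp

/-- The function `θ_ω` does not vanish identically: its constant Fourier coefficient on the unit
circle is `1`. -/
theorem exists_theta_ne_zero (h0 : ω ≠ 0) (h1 : ‖ω‖ < 1) : ∃ z, z ≠ 0 ∧ theta ω z ≠ 0 := by
  by_contra! hcon
  let f : ℤ → C(ℝ, ℂ) := fun n =>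
    ⟨fun x => thetaWeight ω 1 n * Complex.exp ((n * Complex.I) * x), by fun_prop⟩
  have hf (n : ℤ) (x : ℝ) : f n x = thetaWeight ω (Complex.exp (x * Complex.I)) n := by
    have : (-Complex.exp (x * Complex.I)) ^ n = (-1) ^ n * Complex.exp ((n * Complex.I) * x) := by
      rw [← neg_one_mul, mul_zpow, ← Complex.exp_int_mul]
      ring_nf
    simp only [f, ContinuousMap.coe_mk, thetaWeight, this]
    ring
  have hsum : Summable fun n => ‖(f n).restrict
      (⟨Set.uIcc 0 (2 * Real.pi), isCompact_uIcc⟩ : TopologicalSpace.Compacts ℝ)‖ := by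
    refine Summable.of_nonneg_of_le (fun _ => norm_nonneg _) (fun n => ?_)
      (summable_thetaWeight h0 h1 one_ne_zero).norm
    refine (ContinuousMap.norm_le _ (norm_nonneg _)).mpr fun x => ?_
    have : ‖Complex.exp ((n * Complex.I) * (x : ℝ))‖ = 1 := by
      rw [Complex.norm_exp]
      simp
    simp [f, this]
  have key := intervalIntegral.hasSum_intervalIntegral_of_summable_norm hsum
  have hzero : ∀ x : ℝ, ∑' n, f n x = 0 := fun x => by
    simp only [hf]
    exact hcon _ (Complex.exp_ne_zero _)
  simp only [hzero, intervalIntegral.integral_zero] at key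
  have hint : ∀ n : ℤ, n ≠ 0 → ∫ x in (0 : ℝ)..(2 * Real.pi), f n x = 0 := by
    intro n hn
    have hc : (n * Complex.I : ℂ) ≠ 0 := mul_ne_zero (Int.cast_ne_zero.mpr hn) Complex.I_ne_zero
    simp only [f, ContinuousMap.coe_mk, intervalIntegral.integral_const_mul]
    rw [integral_exp_mul_complex hc]
    have : Complex.exp (n * Complex.I * ((2 * Real.pi : ℝ) : ℂ)) = 1 := by
      rw [Complex.exp_eq_one_iff]
      exact ⟨n, by push_cast; ring⟩
    rw [this]
    simp
  have h2 := key.unique (hasSum_single 0 fun n hn => hint n hn)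
  simp [f, thetaWeight, Real.pi_ne_zero] at h2

/-- The odd part of `θ_ω` does not vanish identically and the even part is not constant. -/
theorem exists_theta_parts (h0 : ω ≠ 0) (h1 : ‖ω‖ < 1) :
    ∃ u v : ℂ, u ≠ 0 ∧ v ≠ 0 ∧ theta ω (-v) ≠ theta ω v ∧
      theta ω u + theta ω (-u) ≠ theta ω v + theta ω (-v) := by
  by_contra! hcon
  have hω : ω ≠ 1 := fun h => by simp [h] at h1
  -- quasi-periodicity exchanges the even and the odd part
  have hE {z : ℂ} (hz : z ≠ 0) : theta ω (ω * z) + theta ω (-(ω * z)) =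
      -(theta ω z - theta ω (-z)) / z := by
    rw [← mul_neg, theta_mul_left h0 hz, theta_mul_left h0 (neg_ne_zero.mpr hz), div_neg]
    ring
  have hO {z : ℂ} (hz : z ≠ 0) : theta ω (ω * z) - theta ω (-(ω * z)) =
      -(theta ω z + theta ω (-z)) / z := by
    rw [← mul_neg, theta_mul_left h0 hz, theta_mul_left h0 (neg_ne_zero.mpr hz), div_neg]
    ring
  by_cases hv : ∃ v, v ≠ 0 ∧ theta ω (-v) ≠ theta ω v
  · obtain ⟨v, hv0, hv⟩ := hv
    -- the even part is a constant, which the functional equation forces to vanish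
    have hκ : ∀ z, z ≠ 0 → theta ω z + theta ω (-z) = theta ω v + theta ω (-v) :=
      fun z hz => hcon z v hz hv0 hv
    have e1 := hE (z := ω) h0
    have e2 := hO (z := 1) one_ne_zero
    rw [hκ _ (mul_ne_zero h0 h0)] at e1
    rw [mul_one, hκ _ one_ne_zero, div_one] at e2
    rw [e2, neg_neg, eq_div_iff h0] at e1
    have hκ0 : theta ω v + theta ω (-v) = 0 := by
      by_contra hne
      exact hω (mul_left_cancel₀ hne (e1.trans (mul_one _).symm))
    have e3 := hE hv0
    rw [hκ _ (mul_ne_zero h0 hv0), hκ0, eq_comm, div_eq_zero_iff, or_iff_left hv0, neg_eq_zero,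
      sub_eq_zero] at e3
    exact hv e3.symm
  · push Not at hv
    obtain ⟨z, hz, hz'⟩ := exists_theta_ne_zero h0 h1
    have e1 := hO hz
    rw [hv _ (mul_ne_zero h0 hz), sub_self, eq_comm, div_eq_zero_iff, or_iff_left hz, hv z hz,
      neg_eq_zero, add_self_eq_zero] at e1
    exact hz' e1

end Theta

/-! ### The Cherednik operators in degree one -/

section DegreeOne

variable {N : ℕ}

theorem R_X_left (t : ℂ) {i j : Fin N} (h : i ≠ j) :
    R t i j (X i) = X i + (1 - t) • X j := by
  apply R_eq_of_mul_eq h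
  simp only [sigma, rename_X, Equiv.swap_apply_left, smul_eq_C_mul, C_sub, C_1]
  ring

theorem R_X_right (t : ℂ) {i j : Fin N} (h : i ≠ j) : R t i j (X j) = t • X j := by
  apply R_eq_of_mul_eq h
  simp only [sigma, rename_X, Equiv.swap_apply_right, smul_eq_C_mul, C_sub, C_1]
  ring

theorem R_X_of_ne (t : ℂ) {i j k : Fin N} (hi : k ≠ i) (hj : k ≠ j) :
    R t i j (X k) = X k :=
  R_of_sigma_eq t (by rw [sigma, rename_X, Equiv.swap_apply_of_ne_of_ne hi hj])

theorem gam_X_self (q : ℂ) (i : Fin N) : gam q i (X i) = q⁻¹ • X i := by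
  simp [gam_eq_scale, scale_X, smul_eq_C_mul]

theorem gam_X_of_ne (q : ℂ) {i j : Fin N} (h : j ≠ i) : gam q i (X j) = X j := by
  simp [gam_eq_scale, scale_X, h]

theorem list_prod_R_X_of_notMem (t : ℂ) {i j : Fin N} (hj : j ≠ i) (l : List (Fin N))
    (hl : j ∉ l) : (l.map fun k => R t i k).prod (X j) = X j := by
  induction l with
  | nil => simp
  | cons m l ih =>
    rw [List.mem_cons, not_or] at hl
    rw [List.map_cons, List.prod_cons, Module.End.mul_apply, ih hl.2, R_X_of_ne t hj hl.1]

theorem list_prod_R_X_of_mem (t : ℂ) {i j : Fin N} (l : List (Fin N)) (hl : l.Nodup)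
    (hi : i ∉ l) (hj : j ∈ l) : (l.map fun k => R t i k).prod (X j) = t • X j := by
  induction l with
  | nil => simp at hj
  | cons m l ih =>
    rw [List.nodup_cons] at hl
    rw [List.mem_cons, not_or] at hi
    rw [List.map_cons, List.prod_cons, Module.End.mul_apply]
    rcases List.mem_cons.mp hj with rfl | hjl
    · rw [list_prod_R_X_of_notMem t (Ne.symm hi.1) l hl.1, R_X_right t hi.1]
    · rw [ih hl.2 hi.2 hjl, map_smul,
        R_X_of_ne t (ne_of_mem_of_not_mem hjl hi.2) (ne_of_mem_of_not_mem hjl hl.1)]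

theorem list_prod_R_X_self (t : ℂ) {i : Fin N} (l : List (Fin N)) (hl : l.Nodup)
    (hi : i ∉ l) :
    (l.map fun k => R t i k).prod (X i) = X i + (1 - t) • ∑ j ∈ l.toFinset, X j := by
  induction l with
  | nil => simp
  | cons m l ih =>
    rw [List.nodup_cons] at hl
    rw [List.mem_cons, not_or] at hi
    have hm : m ∉ l.toFinset := by simpa using hl.1
    have hsum : R t i m (∑ j ∈ l.toFinset, X j) = ∑ j ∈ l.toFinset, X j := by
      rw [map_sum]
      refine Finset.sum_congr rfl fun j hj => ?_
      have hjl : j ∈ l := by simpa using hj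
      exact R_X_of_ne t (ne_of_mem_of_not_mem hjl hi.2) (ne_of_mem_of_not_mem hjl hl.1)
    rw [List.map_cons, List.prod_cons, Module.End.mul_apply, ih hl.2 hi.2, map_add, map_smul, hsum,
      R_X_left t hi.1, List.toFinset_cons, Finset.sum_insert hm]
    module

theorem chain_X_of_gt (t : ℂ) {i j : Fin N} (h : i < j) : chain t i (X j) = t • X j :=
  list_prod_R_X_of_mem t _ ((List.nodup_finRange N).filter _) (by simp) (by simpa using h)

theorem chain_X_of_lt (t : ℂ) {i j : Fin N} (h : j < i) : chain t i (X j) = X j :=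
  list_prod_R_X_of_notMem t h.ne _ (by simp [h.le])

theorem chain_X_self (t : ℂ) (i : Fin N) :
    chain t i (X i) = X i + (1 - t) • ∑ j ∈ Finset.Ioi i, X j := by
  have := list_prod_R_X_self t ((List.finRange N).filter (fun j => i < j))
    ((List.nodup_finRange N).filter _) (by simp : i ∉ _)
  rw [chain, this]
  congr 3
  ext j
  simp

theorem cherednik_zero_apply (q t : ℂ) {i : Fin N} (hi : (i : ℕ) = 0) (f : XPoly N) :
    cherednik i q t f = chain t i (gam q i f) := by
  have h : (List.finRange N).filter (fun j => j < i) = [] := by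
    refine List.filter_eq_nil_iff.mpr fun j _ => ?_
    simp [Fin.lt_def, hi]
  rw [cherednik, h, hi]
  simp [chain]

theorem cherednik_one_apply (q : ℂ) {t : ℂ} (ht : t ≠ 0) {i j : Fin N} (hi : (i : ℕ) = 0)
    (hj : (j : ℕ) = 1) (f : XPoly N) :
    cherednik j q t f = t • chain t j (gam q j (R t⁻¹ i j f)) := by
  have h : (List.finRange N).filter (fun k => k < j) = [i] := by
    refine List.perm_singleton.mp ((List.perm_ext_iff_of_nodup
      ((List.nodup_finRange N).filter _) (List.nodup_singleton i)).mpr fun k => ?_)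
    simp only [List.mem_filter, List.mem_finRange, true_and, decide_eq_true_eq,
      List.mem_singleton, Fin.lt_def, Fin.ext_iff]
    omega
  rw [cherednik, h, hj]
  simp [chain, inverse_R ht]

/-- If `A(q^n, t^n) f` is the sum of the vectors `z_k^n g_k`, then `Pθ_ω(uA) f` is the sum of the
vectors `θ_ω(u z_k) g_k`. -/
theorem Ptheta_apply {V : Type*} [AddCommGroup V] [Module ℂ V] {ω u q t : ℂ} (h0 : ω ≠ 0)
    (h1 : ‖ω‖ < 1) (hu : u ≠ 0) {A : ℂ → ℂ → V →ₗ[ℂ] V} (hA : OpSummable (PthetaTerm ω u A q t))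
    {f : V} {m : ℕ} (z : Fin m → ℂ) (g : Fin m → V) (hz : ∀ k, z k ≠ 0)
    (hf : ∀ n : ℤ, A (q ^ n) (t ^ n) f = ∑ k, z k ^ n • g k) :
    Ptheta ω u A q t f = ∑ k, theta ω (u * z k) • g k := by
  refine eq_of_forall_hasSum (hA.hasOpSum f) fun φ => ?_
  have := hasSum_sum fun (k : Fin m) (_ : k ∈ Finset.univ) =>
    ((summable_thetaWeight h0 h1 (mul_ne_zero hu (hz k))).hasSum).mul_right (φ (g k))
  simp only [map_sum, map_smul, smul_eq_mul]
  have e : (fun n => φ (PthetaTerm ω u A q t n f)) =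
      fun n => ∑ k, thetaWeight ω (u * z k) n * φ (g k) := by
    funext n
    rw [PthetaTerm, LinearMap.smul_apply, hf, map_smul, map_sum, smul_eq_mul, Finset.mul_sum]
    refine Finset.sum_congr rfl fun k _ => ?_
    rw [map_smul, smul_eq_mul, thetaWeight, ← neg_mul, mul_zpow]
    ring
  rw [e]
  exact this

/-- The coefficient of `x_3` in the commutator of `Pθ_ω(uC_1)` and `Pθ_ω(uC_2)` applied to `x_1`
does not vanish for `t = -1` and suitable `q` and `u`: up to sign, with `v = u / q`, it is the
product of `θ(v) - θ(-v)` and `θ(u) + θ(-u) - θ(v) - θ(-v)`. -/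
theorem exists_Ptheta_not_commute {ω : ℂ} (h0 : ω ≠ 0) (h1 : ‖ω‖ < 1) (hN : 3 ≤ N) :
    ∃ q t u : ℂ, q ≠ 0 ∧ t ≠ 0 ∧ u ≠ 0 ∧ ∃ i j : Fin N,
      Ptheta ω u (cherednik i) q t * Ptheta ω u (cherednik j) q t ≠
        Ptheta ω u (cherednik j) q t * Ptheta ω u (cherednik i) q t := by
  obtain ⟨u, v, hu, hv, hodd, heven⟩ := exists_theta_parts h0 h1
  -- `q` and `t` are kept opaque so that the powers below stay in the form `q ^ n`, `t ^ n`
  obtain ⟨q, hq, hqv⟩ : ∃ q : ℂ, q ≠ 0 ∧ u * q⁻¹ = v :=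
    ⟨u / v, div_ne_zero hu hv, by field_simp⟩
  obtain ⟨t, ht1⟩ : ∃ t : ℂ, t = -1 := ⟨-1, rfl⟩
  have ht : t ≠ 0 := by rw [ht1]; norm_num
  -- the variables `x_1`, `x_2`, `x_3` have the indices `0`, `1`, `2` in `Fin N`
  obtain ⟨i, hi⟩ : ∃ i : Fin N, (i : ℕ) = 0 := ⟨⟨0, by omega⟩, rfl⟩
  obtain ⟨j, hj⟩ : ∃ j : Fin N, (j : ℕ) = 1 := ⟨⟨1, by omega⟩, rfl⟩
  obtain ⟨l, hl⟩ : ∃ l : Fin N, (l : ℕ) = 2 := ⟨⟨2, by omega⟩, rfl⟩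
  refine ⟨q, t, u, hq, ht, hu, i, j, fun hcomm => ?_⟩
  have hij : i < j := by rw [Fin.lt_def]; omega
  let Y : XPoly N := ∑ k ∈ Finset.Ioi j, X k
  have hIoi : Finset.Ioi i = insert j (Finset.Ioi j) := by
    ext k
    simp only [Finset.mem_Ioi, Finset.mem_insert, Fin.lt_def, Fin.ext_iff]
    omega
  have hsum : ∑ k ∈ Finset.Ioi i, (X k : XPoly N) = X j + Y := by
    rw [hIoi, Finset.sum_insert (by simp)]
  have hgt {k : Fin N} (hk : k ∈ Finset.Ioi j) : j < k := Finset.mem_Ioi.mp hk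
  have hchi (t : ℂ) : chain t i Y = t • Y := by
    simp only [Y, map_sum, Finset.smul_sum]
    exact Finset.sum_congr rfl fun k hk => chain_X_of_gt t (hij.trans (hgt hk))
  have hchj (t : ℂ) : chain t j Y = t • Y := by
    simp only [Y, map_sum, Finset.smul_sum]
    exact Finset.sum_congr rfl fun k hk => chain_X_of_gt t (hgt hk)
  have hRY (t : ℂ) : R t i j Y = Y := by
    simp only [Y, map_sum]
    exact Finset.sum_congr rfl fun k hk => R_X_of_ne t (hij.trans (hgt hk)).ne' (hgt hk).ne'
  have hgi (q : ℂ) : gam q i Y = Y := by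
    simp only [Y, map_sum]
    exact Finset.sum_congr rfl fun k hk => gam_X_of_ne q (hij.trans (hgt hk)).ne'
  have hgj (q : ℂ) : gam q j Y = Y := by
    simp only [Y, map_sum]
    exact Finset.sum_congr rfl fun k hk => gam_X_of_ne q (hgt hk).ne'
  -- the operators `C_1` and `C_2` on the span of `x_1`, `x_2` and `Y = x_3 + ⋯ + x_N`
  have hCi_i (q t : ℂ) : cherednik i q t (X i) =
      q⁻¹ • (X i + X j + Y) + (t * q⁻¹) • (-X j - Y) := by
    rw [cherednik_zero_apply q t hi, gam_X_self, map_smul, chain_X_self, hsum]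
    module
  have hCi_j (q t : ℂ) : cherednik i q t (X j) = t • X j := by
    rw [cherednik_zero_apply q t hi, gam_X_of_ne q hij.ne', chain_X_of_gt t hij]
  have hCi_Y (q t : ℂ) : cherednik i q t Y = t • Y := by
    rw [cherednik_zero_apply q t hi, hgi, hchi]
  have hCj_i (q : ℂ) {t : ℂ} (ht : t ≠ 0) : cherednik j q t (X i) = t • X i +
      q⁻¹ • (-X j - Y) + (t * q⁻¹) • (X j + (2 : ℂ) • Y) + (t ^ 2 * q⁻¹) • (-Y) := by
    rw [cherednik_one_apply q ht hi hj, R_X_left _ hij.ne, map_add, map_smul,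
      gam_X_of_ne q hij.ne, gam_X_self, map_add, map_smul, map_smul, chain_X_of_lt t hij,
      chain_X_self]
    match_scalars <;> field_simp <;> ring
  have hCj_j (q : ℂ) {t : ℂ} (ht : t ≠ 0) : cherednik j q t (X j) =
      q⁻¹ • (X j + Y) + (t * q⁻¹) • (-Y) := by
    rw [cherednik_one_apply q ht hi hj, R_X_right _ hij.ne, map_smul, gam_X_self, map_smul,
      map_smul, chain_X_self]
    match_scalars
    · field_simp
    · field_simp
      ring
  have hCj_Y (q : ℂ) {t : ℂ} (ht : t ≠ 0) : cherednik j q t Y = (t ^ 2) • Y := by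
    rw [cherednik_one_apply q ht hi hj, hRY, hgj, hchj, smul_smul, sq]
  have htn (n : ℤ) : t ^ n ≠ 0 := zpow_ne_zero n ht
  have htsq (n : ℤ) : (t ^ 2) ^ n = (t ^ n) ^ 2 := by rw [sq, mul_zpow, ← sq]
  have hs (k : Fin N) := opSummable_PthetaTerm_cherednik h0 h1 hq ht hu k
  have hPi_i := Ptheta_apply h0 h1 hu (hs i) (f := X i) ![q⁻¹, t * q⁻¹]
    ![X i + X j + Y, -X j - Y]
    (by simp [Fin.forall_fin_succ, hq, ht])
    (fun n => by simp only [hCi_i, Fin.sum_univ_succ, mul_zpow, inv_zpow, Matrix.cons_val_zero,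
      Matrix.cons_val_succ, Fin.sum_univ_zero, add_zero])
  have hPi_j := Ptheta_apply h0 h1 hu (hs i) (f := X j) ![t] ![X j]
    (by simp [ht]) (fun n => by simp [hCi_j])
  have hPi_Y := Ptheta_apply h0 h1 hu (hs i) (f := Y) ![t] ![Y]
    (by simp [ht]) (fun n => by simp [hCi_Y])
  have hPj_i := Ptheta_apply h0 h1 hu (hs j) (f := X i)
    ![t, q⁻¹, t * q⁻¹, t ^ 2 * q⁻¹] ![X i, -X j - Y, X j + (2 : ℂ) • Y, -Y]
    (by simp [Fin.forall_fin_succ, hq, ht])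
    (fun n => by simp only [hCj_i _ (htn n), Fin.sum_univ_succ, mul_zpow, inv_zpow, htsq,
      Matrix.cons_val_zero, Matrix.cons_val_succ, Fin.sum_univ_zero, add_zero, add_assoc])
  have hPj_j := Ptheta_apply h0 h1 hu (hs j) (f := X j) ![q⁻¹, t * q⁻¹]
    ![X j + Y, -Y]
    (by simp [Fin.forall_fin_succ, hq, ht])
    (fun n => by simp only [hCj_j _ (htn n), Fin.sum_univ_succ, mul_zpow, inv_zpow,
      Matrix.cons_val_zero, Matrix.cons_val_succ, Fin.sum_univ_zero, add_zero])
  have hPj_Y := Ptheta_apply h0 h1 hu (hs j) (f := Y) ![t ^ 2] ![Y]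
    (by simp [ht]) (fun n => by simp [hCj_Y _ (htn n), htsq])
  have z1 : u * (t * q⁻¹) = -v := by rw [ht1, ← hqv]; ring
  have z2 : u * (t ^ 2 * q⁻¹) = v := by rw [ht1, ← hqv]; ring
  have z3 : u * t = -u := by rw [ht1]; ring
  have z4 : u * t ^ 2 = u := by rw [ht1]; ring
  simp only [Fin.sum_univ_succ, Fin.sum_univ_zero, Matrix.cons_val_zero, Matrix.cons_val_succ,
    add_zero, hqv, z1, z2, z3, z4] at hPi_i hPi_j hPi_Y hPj_i hPj_j hPj_Y
  have key := LinearMap.congr_fun hcomm (X i)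
  rw [Module.End.mul_apply, Module.End.mul_apply, hPi_i, hPj_i] at key
  simp only [map_add, map_sub, map_neg, map_smul, hPi_i, hPj_i, hPi_j, hPj_j, hPi_Y, hPj_Y] at key
  -- comparison of the coefficients of `Y`
  have hYl : eval (fun k => if k = l then (1 : ℂ) else 0) Y = 1 := by
    simp only [Y, map_sum, eval_X]
    rw [Finset.sum_ite_eq' , if_pos]
    rw [Finset.mem_Ioi, Fin.lt_def]
    omega
  have hil : i ≠ l := fun h => by rw [h] at hi; omega
  have hjl : j ≠ l := fun h => by rw [h] at hj; omega
  have key2 := congrArg (eval fun k => if k = l then (1 : ℂ) else 0) key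
  simp only [map_add, map_sub, map_neg, smul_eval, eval_X, hYl, if_neg hil, if_neg hjl] at key2
  have hfin : (theta ω (-v) - theta ω v) *
      ((theta ω u + theta ω (-u)) - (theta ω v + theta ω (-v))) = 0 := by
    linear_combination key2
  rcases mul_eq_zero.mp hfin with h | h
  · exact hodd (sub_eq_zero.mp h)
  · exact heven (sub_eq_zero.mp h)

end DegreeOne

end

end DellCherednik

theorem mainTheorem1 (N : ℕ) (ω : ℂ) (hω0 : ω ≠ 0) (hω1 : ‖ω‖ < 1) :
    (∀ q t u : ℂ, q ≠ 0 → t ≠ 0 → u ≠ 0 →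
      (∀ i : Fin N, OpSummable (PthetaTerm ω u (cherednik i) q t)) ∧
      OpSummable (dellTerm N ω u q t) ∧
      ∀ f ∈ MvPolynomial.symmetricSubalgebra (Fin N) ℂ,
        dell N ω u q t f = algebraMap (XPoly N) (RatFun N)
          ((List.ofFn fun i : Fin N => Ptheta ω u (cherednik i) q t).prod f)) ∧
    (3 ≤ N → ∃ q t u : ℂ, q ≠ 0 ∧ t ≠ 0 ∧ u ≠ 0 ∧ ∃ i j : Fin N,
      Ptheta ω u (cherednik i) q t * Ptheta ω u (cherednik j) q t ≠
        Ptheta ω u (cherednik j) q t * Ptheta ω u (cherednik i) q t) := by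
  refine ⟨fun q t u hq ht hu => ⟨opSummable_PthetaTerm_cherednik hω0 hω1 hq ht hu,
    opSummable_dellTerm hω0 hω1 hq ht hu, fun f hf => dell_eq_prod_Ptheta hω0 hω1 hq ht hu hf⟩,
    fun hN => exists_Ptheta_not_commute hω0 hω1 hN⟩
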